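/- There is an absolute constant $C>0$ with the following property. Let $n\ge 1$ and $N,m,s\ge 0$ be integers, let $T:\mathbb{C}^n\to\mathbb{C}^N$ be an injective linear map, let $T^*$ be its adjoint, $T^\dagger$ its Moore--Penrose pseudoinverse, and $\widetilde T=(T^\dagger)^*$. Write $\|\cdot\|_{p\to q}$ for the operator norm from $\ell_p$ to $\ell_q$ and $\|\cdot\|=\|\cdot\|_{2\to2}$. Let $$\gamma=\operatorname*{arg\,min}_{\tilde\gamma>0}\|\tilde\gamma T^*T-I_n\|,\qquad \mu=\max_{1\le k\le n}\max\left\{n\|\gamma^{1/2}Te_k\|_\infty^2,\ n\|\gamma^{-1/2}\widetilde Te_k\|_\infty^2\right\},$$ where $e_1,\dots,e_n$ is the standard basis of $\mathbb{C}^n$. Let $x\in\mathbb{C}^n$ be a fixed vector such that $Tx$ has at most $s$ nonzero entries, and let $\beta\in\mathbb{R}$. Let $\omega_1,\dots,\omega_m$ be independent random indices, each uniformly distributed on $\{1,\dots,n\}$, and let $S_\Omega:\mathbb{C}^n\to\mathbb{C}^m$ be the sampling operator $(S_\Omega g)[j]=g[\omega_j]$. If $$m\ \ge\ \frac{C(1+\beta)\,\mu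 s}{1-\|\gamma T^*T-I_n\|}\left[\log N+\log\left(\|T\|_{1\to2}\,\|T^\dagger\|_{2\to\infty}\right)\right],$$ then, with probability at least $1-e^{-\beta}-3/n$, $x$ is the unique minimizer of $$\min_{g\in\mathbb{C}^n}\ \|Tg\|_1\quad\text{subject to}\quad S_\Omega g=S_\Omega x .$$ -/

import Mathlib

open MeasureTheory ProbabilityTheory
open scoped ENNReal Matrix

noncomputable section

namespace TransformSparse

/-- The operator norm of a matrix `A`, seen as a linear map from `ℓ_p^b` to `ℓ_q^a`. -/
def opNorm {a b : ℕ} (p q : ℝ≥0∞) [Fact (1 ≤ p)] [Fact (1 ≤ q)]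
    (A : Matrix (Fin a) (Fin b) ℂ) : ℝ :=
  ‖LinearMap.toContinuousLinearMap (Matrix.toLpLin p q A)‖

/-- The spectral norm `‖A‖ = ‖A‖_{2 → 2}`. -/
def specNorm {a b : ℕ} (A : Matrix (Fin a) (Fin b) ℂ) : ℝ := opNorm 2 2 A

/-- `B` is the Moore-Penrose pseudoinverse of `A` (the four Penrose equations, which have exactly
one solution `B`). -/
structure IsPseudoinverse {a b : ℕ} (A : Matrix (Fin a) (Fin b) ℂ)
    (B : Matrix (Fin b) (Fin a) ℂ) : Prop where
  mul_mul_left : A * B * A = A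
  mul_mul_right : B * A * B = B
  left_hermitian : (A * B).IsHermitian
  right_hermitian : (B * A).IsHermitian

/-- The Moore-Penrose pseudoinverse is unique. -/
theorem IsPseudoinverse.unique {a b : ℕ} {A : Matrix (Fin a) (Fin b) ℂ}
    {B C : Matrix (Fin b) (Fin a) ℂ} (hB : IsPseudoinverse A B) (hC : IsPseudoinverse A C) :
    B = C := by
  have h1 : A * B = A * C := by
    calc A * B = (A * B)ᴴ := hB.left_hermitian.eq.symm
      _ = (A * C * (A * B))ᴴ := by rw [← Matrix.mul_assoc, hC.mul_mul_left]
      _ = A * B * (A * C) := by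
          rw [Matrix.conjTranspose_mul, hB.left_hermitian.eq, hC.left_hermitian.eq]
      _ = A * C := by rw [← Matrix.mul_assoc, hB.mul_mul_left]
  have h2 : B * A = C * A := by
    calc B * A = (B * A)ᴴ := hB.right_hermitian.eq.symm
      _ = (B * A * (C * A))ᴴ := by rw [Matrix.mul_assoc, ← Matrix.mul_assoc A, hC.mul_mul_left]
      _ = C * A * (B * A) := by
          rw [Matrix.conjTranspose_mul, hB.right_hermitian.eq, hC.right_hermitian.eq]
      _ = C * A := by rw [Matrix.mul_assoc, ← Matrix.mul_assoc A, hB.mul_mul_left]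
  calc B = B * A * B := hB.mul_mul_right.symm
    _ = C * (A * B) := by rw [h2, Matrix.mul_assoc]
    _ = C := by rw [h1, ← Matrix.mul_assoc, hC.mul_mul_right]

/-- `γ` is a minimizer of `t ↦ ‖t T* T - I‖` over `t > 0`. -/
def IsOptimalScaling {n N : ℕ} (T : Matrix (Fin N) (Fin n) ℂ) (γ : ℝ) : Prop :=
  0 < γ ∧ IsMinOn (fun t : ℝ => specNorm (t • (Tᴴ * T) - 1)) (Set.Ioi 0) γ

/-- The incoherence `max_k max (n ‖γ^{1/2} T e_k‖_∞², n ‖γ^{-1/2} T̃ e_k‖_∞²)`, where the second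
matrix argument `Tt` stands for `T̃ = (T†)*`; the norm of a function `Fin N → ℂ` is its
maximum norm. -/
def incoherence {n N : ℕ} (T Tt : Matrix (Fin N) (Fin n) ℂ) (γ : ℝ) : ℝ :=
  ⨆ k : Fin n, max ((n : ℝ) * ‖(γ ^ (1 / 2 : ℝ)) • T.col k‖ ^ 2)
    ((n : ℝ) * ‖(γ ^ (-(1 / 2) : ℝ)) • Tt.col k‖ ^ 2)

/-- The `ℓ_1` norm of a vector. -/
def l1Norm {N : ℕ} (z : Fin N → ℂ) : ℝ := ∑ i, ‖z i‖

/-- A vector with at most `s` nonzero entries. -/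
def IsSparse {N : ℕ} (s : ℕ) (z : Fin N → ℂ) : Prop := (Function.support z).ncard ≤ s

/-- The sampling operator: the `j`th entry of the output is the `idx j`th entry of the input. -/
def sample {m n : ℕ} (idx : Fin m → Fin n) (g : Fin n → ℂ) : Fin m → ℂ := fun j => g (idx j)

/-- `x` is the unique minimizer of `f` over the set `K`. -/
def IsUniqueMinimizer {E : Type*} (f : E → ℝ) (K : Set E) (x : E) : Prop :=
  x ∈ K ∧ IsMinOn f K x ∧ ∀ y ∈ K, IsMinOn f K y → y = x

/-- `x` is the unique minimizer of `‖T g‖₁` subject to agreeing with `x` at the sampled indices. -/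
def IsRecovered {m n N : ℕ} (T : Matrix (Fin N) (Fin n) ℂ) (x : Fin n → ℂ)
    (idx : Fin m → Fin n) : Prop :=
  IsUniqueMinimizer (fun g => l1Norm (T *ᵥ g)) {g | sample idx g = sample idx x} x

end TransformSparse

end

open scoped BigOperators

namespace TransformSparse

/-! ### Uniform averages over finite types: second moments, exponential moments, union and Markov
bounds -/

section Averages

variable {α β : Type*} [Fintype α] [Fintype β]

/-! The proof is a golfing scheme, repeated on independent groups of samples. Put `U = γ^{1/2} T`
and `V = γ^{-1/2} T̃`, so that `Vᴴ * U = 1`, and let `J` be the support of `Tx`. A perturbation `h`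
that vanishes on the samples makes `Uh` orthogonal to every `w` for which `Uᴴ w` vanishes off the
samples. If such a `w` nearly equals the sign of `Ux` on `J` and is at most `1/2` off `J`, then
`‖U(x + h)‖₁ > ‖Ux‖₁`, provided that `Uh` on `J` is controlled by `Uh` off `J`. That control also
comes from certificates, one for each basis vector `e_i` with `i ∈ J`, rather than from a matrix
concentration inequality (`isStrictMinimizer_of_certificates`).

All certificates are built from the same batches. Each batch adds the current residual plus the
sampling fluctuation of `V Uᴴ` applied to it, and the new residual is minus that fluctuation
restricted to `J`. Residuals shrink geometrically in mean square, by a plain variance computation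
(`expect_nsq_residual_le`) and Markov's inequality. Off `J`, the sign certificate is a sum of
fluctuations, bounded through exponential moments on the event that the earlier residuals are small
(`expect_exp_certificate_le`). The basis certificates need only a deterministic bound, polynomial in
`N` and in `M = ‖T‖_{1→2} ‖T†‖_{2→∞}`, because the final residual is exponentially small in the
number of batches. This is where `log N + log M` comes from.

A single group succeeds with probability at least `1/2` (`exists_frac_not_isStrictMinimizer_le`).
Extra samples never hurt, so recovery fails only if `2⌈β⌉` independent groups all fail, which has
probability at most `e^{-β}`. The term `3/n` serves only to make `n = 1` trivial, and the factor
`1/(1 - δ)`, with `δ = ‖γ T*T - I‖ < 1`, is used only as a number that is at least `1`. -/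

theorem expect_prod_type (f : α × β → ℝ) : 𝔼 x, f x = 𝔼 a, 𝔼 b, f (a, b) := by
  rw [← Finset.univ_product_univ, Finset.expect_product]

theorem expect_fin_succ {m : ℕ} (f : (Fin (m + 1) → α) → ℝ) :
    𝔼 b, f b = 𝔼 a : α, 𝔼 b : Fin m → α, f (Fin.cons a b) := by
  rw [← expect_prod_type (fun x : α × (Fin m → α) => f (Fin.cons x.1 x.2))]
  exact (Fintype.expect_equiv (Fin.consEquiv fun _ => α) _ _ (fun x => rfl)).symm

theorem expect_sum_arrow {ι κ : Type*} [Fintype ι] [Fintype κ] [DecidableEq ι] [DecidableEq κ]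
    (f : (ι ⊕ κ → α) → ℝ) :
    𝔼 p, f p = 𝔼 a : ι → α, 𝔼 b : κ → α, f (Sum.elim a b) := by
  rw [← expect_prod_type (fun x : (ι → α) × (κ → α) => f (Sum.elim x.1 x.2))]
  exact Fintype.expect_equiv (Equiv.sumArrowEquivProdArrow ι κ α) _ _ (fun p => by
    rw [← Sum.elim_comp_inl_inr p]; rfl)

theorem expect_mono {f g : α → ℝ} (h : ∀ a, f a ≤ g a) : 𝔼 a, f a ≤ 𝔼 a, g a :=
  Finset.expect_le_expect fun a _ => h a

theorem expect_nonneg' {f : α → ℝ} (h : ∀ a, 0 ≤ f a) : 0 ≤ 𝔼 a, f a :=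
  Finset.expect_nonneg fun a _ => h a

theorem expect_re (f : α → ℂ) : (𝔼 a, f a).re = 𝔼 a, (f a).re := by
  rw [Fintype.expect_eq_sum_div_card, Fintype.expect_eq_sum_div_card, ← Complex.re_sum]
  simp

/-- Averaging over `Fin m → α` makes the draws independent, so the cross terms vanish because each
draw has mean zero. -/
theorem expect_norm_sq_sum [Nonempty α] (Y : α → ℂ) (hY : ∑ a, Y a = 0) (m : ℕ) :
    𝔼 b : Fin m → α, ‖∑ j, Y (b j)‖ ^ 2 = m * 𝔼 a, ‖Y a‖ ^ 2 := by
  induction m with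
  | zero => simp
  | succ m ih =>
    have h0 : 𝔼 a, Y a = 0 := by simp [Fintype.expect_eq_sum_div_card, hY]
    have key : ∀ a : α, 𝔼 b : Fin m → α, ‖Y a + ∑ j, Y (b j)‖ ^ 2
        = ‖Y a‖ ^ 2 + 2 * (Y a * (starRingEnd ℂ) (𝔼 b : Fin m → α, ∑ j, Y (b j))).re
          + m * 𝔼 a, ‖Y a‖ ^ 2 := by
      intro a
      rw [← ih]
      have h1 : (Y a * (starRingEnd ℂ) (𝔼 b : Fin m → α, ∑ j, Y (b j))).re
          = 𝔼 b : Fin m → α, (Y a * (starRingEnd ℂ) (∑ j, Y (b j))).re := by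
        rw [← expect_re, ← Finset.mul_expect]
        congr 2
        simp [Fintype.expect_eq_sum_div_card]
      rw [h1, Finset.mul_expect]
      have h2 : ‖Y a‖ ^ 2 = 𝔼 _b : Fin m → α, ‖Y a‖ ^ 2 := (Fintype.expect_const _).symm
      conv_rhs => rw [h2]
      rw [← Finset.expect_add_distrib, ← Finset.expect_add_distrib]
      refine Finset.expect_congr rfl fun b _ => ?_
      simp only [← Complex.normSq_eq_norm_sq, Complex.normSq_add]
      ring
    rw [expect_fin_succ]
    simp only [Fin.sum_univ_succ, Fin.cons_zero, Fin.cons_succ, key]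
    rw [Finset.expect_add_distrib, Finset.expect_add_distrib, Fintype.expect_const,
      ← Finset.mul_expect, ← expect_re, ← Finset.expect_mul, h0]
    push_cast
    simp
    ring

theorem expect_norm_sq_sub_le [Nonempty α] (ξ : α → ℂ) :
    𝔼 a, ‖ξ a - 𝔼 a, ξ a‖ ^ 2 ≤ 𝔼 a, ‖ξ a‖ ^ 2 := by
  set μ := 𝔼 a, ξ a with hμ
  have h1 : 𝔼 a, ‖ξ a - μ‖ ^ 2 = (𝔼 a, ‖ξ a‖ ^ 2) - ‖μ‖ ^ 2 := by
    have h2 : ∀ a, ‖ξ a - μ‖ ^ 2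
        = ‖ξ a‖ ^ 2 + ‖μ‖ ^ 2 - 2 * (ξ a * (starRingEnd ℂ) μ).re := by
      intro a
      simp only [← Complex.normSq_eq_norm_sq, Complex.normSq_sub]
    simp only [h2]
    rw [Finset.expect_sub_distrib, Finset.expect_add_distrib, Fintype.expect_const,
      ← Finset.mul_expect, ← expect_re, ← Finset.expect_mul, ← hμ, Complex.mul_conj,
      Complex.normSq_eq_norm_sq, Complex.ofReal_re]
    ring
  rw [h1]
  nlinarith [sq_nonneg ‖μ‖]

theorem expect_norm_sq_average_sub_le [Nonempty α] (ξ : α → ℂ) {m : ℕ} (hm : 0 < m) :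
    𝔼 b : Fin m → α, ‖(1 / m : ℂ) * ∑ j, ξ (b j) - 𝔼 a, ξ a‖ ^ 2
      ≤ (1 / m : ℝ) * 𝔼 a, ‖ξ a‖ ^ 2 := by
  set μ := 𝔼 a, ξ a with hμ
  have hm' : (m : ℂ) ≠ 0 := by exact_mod_cast hm.ne'
  have hm'' : (m : ℝ) ≠ 0 := by exact_mod_cast hm.ne'
  have h1 : ∀ b : Fin m → α, ‖(1 / m : ℂ) * ∑ j, ξ (b j) - μ‖ ^ 2
      = (1 / m : ℝ) ^ 2 * ‖∑ j, (ξ (b j) - μ)‖ ^ 2 := by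
    intro b
    have : (1 / m : ℂ) * ∑ j, ξ (b j) - μ = (1 / m : ℂ) * ∑ j, (ξ (b j) - μ) := by
      rw [Finset.sum_sub_distrib]
      simp
      field_simp
    rw [this, norm_mul, mul_pow]
    simp
  have h0 : ∑ a, (ξ a - μ) = 0 := by
    rw [Finset.sum_sub_distrib, hμ, ← Fintype.card_smul_expect]
    simp
  simp only [h1]
  rw [← Finset.mul_expect, expect_norm_sq_sum (fun a => ξ a - μ) h0]
  have := expect_norm_sq_sub_le ξ
  calc (1 / m : ℝ) ^ 2 * (m * 𝔼 a, ‖ξ a - μ‖ ^ 2) = (1 / m : ℝ) * 𝔼 a, ‖ξ a - μ‖ ^ 2 := by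
        field_simp
    _ ≤ _ := by gcongr

theorem expect_exp_sum (g : α → ℝ) (m : ℕ) :
    𝔼 b : Fin m → α, Real.exp (∑ j, g (b j)) = (𝔼 a, Real.exp (g a)) ^ m := by
  induction m with
  | zero => simp
  | succ m ih =>
    rw [expect_fin_succ]
    simp only [Fin.sum_univ_succ, Fin.cons_zero, Fin.cons_succ, Real.exp_add,
      ← Finset.mul_expect, ih]
    rw [← Finset.expect_mul, pow_succ']

/-- For `|t| ≤ 1` one has `e^t ≤ 1 + t + t²`, and the linear term averages to zero. -/
theorem expect_exp_le [Nonempty α] (g : α → ℝ) (h0 : 𝔼 a, g a = 0) (h1 : ∀ a, |g a| ≤ 1) :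
    𝔼 a, Real.exp (g a) ≤ Real.exp (𝔼 a, g a ^ 2) := by
  calc 𝔼 a, Real.exp (g a) ≤ 𝔼 a, (1 + g a + g a ^ 2) := by
        refine expect_mono fun a => ?_
        have := (abs_le.1 (Real.abs_exp_sub_one_sub_id_le (h1 a))).2
        linarith
    _ = 𝔼 a, g a ^ 2 + 1 := by
        rw [Finset.expect_add_distrib, Finset.expect_add_distrib, h0, Fintype.expect_const]
        ring
    _ ≤ _ := Real.add_one_le_exp _

open Classical in
/-- The fraction of the elements of a finite type that satisfy a predicate. -/
noncomputable def frac {α : Type*} [Fintype α] (p : α → Prop) : ℝ := 𝔼 a, if p a then 1 else 0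

theorem frac_mono {p q : α → Prop} (h : ∀ a, p a → q a) : frac p ≤ frac q := by
  refine expect_mono fun a => ?_
  have := h a
  split_ifs <;> simp_all

theorem frac_or_le (p q : α → Prop) : frac (fun a => p a ∨ q a) ≤ frac p + frac q := by
  rw [frac, frac, frac, ← Finset.expect_add_distrib]
  refine expect_mono fun a => ?_
  by_cases hp : p a <;> by_cases hq : q a <;> simp [hp, hq]

theorem frac_exists_le {κ : Type*} [Fintype κ] (p : κ → α → Prop) :
    frac (fun a => ∃ k, p k a) ≤ ∑ k, frac (p k) := by
  classical
  simp only [frac]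
  rw [← Finset.expect_sum_comm]
  refine expect_mono fun a => ?_
  split_ifs with h
  · obtain ⟨k, hk⟩ := h
    refine le_trans ?_ (Finset.single_le_sum (f := fun k => if p k a then (1 : ℝ) else 0)
      (fun k _ => by positivity) (Finset.mem_univ k))
    simp [hk]
  · positivity

/-- Markov's inequality. -/
theorem frac_le_of_le {p : α → Prop} {f : α → ℝ} {t : ℝ} (ht : 0 < t) (hf : ∀ a, 0 ≤ f a)
    (h : ∀ a, p a → t ≤ f a) : frac p ≤ (𝔼 a, f a) / t := by
  rw [frac, Finset.expect_div]
  refine expect_mono fun a => ?_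
  split_ifs with hp
  · rw [le_div_iff₀ ht, one_mul]
    exact h a hp
  · exact div_nonneg (hf a) ht.le

end Averages

/-- The squared Euclidean norm of a vector. -/
noncomputable def nsq {ι : Type*} [Fintype ι] (q : ι → ℂ) : ℝ := ∑ i, ‖q i‖ ^ 2

theorem nsq_nonneg {ι : Type*} [Fintype ι] (q : ι → ℂ) : 0 ≤ nsq q :=
  Finset.sum_nonneg fun _ _ => by positivity

theorem norm_sq_le_nsq {ι : Type*} [Fintype ι] (q : ι → ℂ) (i : ι) : ‖q i‖ ^ 2 ≤ nsq q :=
  Finset.single_le_sum (f := fun i => ‖q i‖ ^ 2) (fun _ _ => by positivity) (Finset.mem_univ i)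

theorem norm_sum_mul_sq_le {ι : Type*} (s : Finset ι) (f g : ι → ℂ) :
    ‖∑ i ∈ s, f i * g i‖ ^ 2 ≤ (∑ i ∈ s, ‖f i‖ ^ 2) * ∑ i ∈ s, ‖g i‖ ^ 2 := by
  refine le_trans ?_ (Finset.sum_mul_sq_le_sq_mul_sq s (fun i => ‖f i‖) fun i => ‖g i‖)
  gcongr
  exact (norm_sum_le _ _).trans_eq (Finset.sum_congr rfl fun i _ => norm_mul _ _)

/-- A pair of dual frames with incoherence `μ` and controlled norms. -/
structure IsIncoherentPair {n N : ℕ} (U V : Matrix (Fin N) (Fin n) ℂ) (μ M : ℝ) : Prop where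
  dual : Vᴴ * U = 1
  left_entry : ∀ i k, n * ‖U i k‖ ^ 2 ≤ μ
  right_entry : ∀ i k, n * ‖V i k‖ ^ 2 ≤ μ
  bound : ∀ q : Fin N → ℂ, nsq (Uᴴ *ᵥ q) ≤ 2 * nsq q
  col_bound : ∀ k, nsq (U.col k) * nsq (V.col k) ≤ M ^ 2

/-! ### Fluctuations within one batch: variance and exponential moments -/

section Batch

variable {n N : ℕ} (U V : Matrix (Fin N) (Fin n) ℂ)

/-- The contribution of the sample `k` to the entry `i` of the sampled reconstruction of `q`. -/
def sampleTerm (q : Fin N → ℂ) (i : Fin N) (k : Fin n) : ℂ :=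
  n * (V i k * (Uᴴ *ᵥ q) k)

/-- The fluctuation of the average of the sample terms over a batch. -/
noncomputable def fluctuation {m : ℕ} (b : Fin m → Fin n) (q : Fin N → ℂ) (i : Fin N) : ℂ :=
  (1 / m : ℂ) * ∑ j, sampleTerm U V q i (b j) - 𝔼 k, sampleTerm U V q i k

variable {U V} {μ M : ℝ}

theorem IsIncoherentPair.dual' (h : IsIncoherentPair U V μ M) : Uᴴ * V = 1 := by
  have := congrArg Matrix.conjTranspose h.dual
  simpa using this

theorem IsIncoherentPair.nonneg (h : IsIncoherentPair U V μ M) (i : Fin N) (k : Fin n) : 0 ≤ μ :=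
  le_trans (by positivity) (h.left_entry i k)

/-- Incoherence is spent only on `V`, while the sum over `k` is handled by the frame bound on `Uᴴ`.
Hence the variance has no factor `J.card`, unlike the pointwise bound in `norm_sampleTerm_sq_le`. -/
theorem expect_norm_sampleTerm_sq_le [NeZero n] (h : IsIncoherentPair U V μ M) (q : Fin N → ℂ)
    (i : Fin N) : 𝔼 k, ‖sampleTerm U V q i k‖ ^ 2 ≤ 2 * μ * nsq q := by
  have hn := Nat.pos_of_neZero n
  have hμ := h.nonneg i 0
  have hn' : (0 : ℝ) < n := by exact_mod_cast hn
  have h1 : ∀ k, ‖sampleTerm U V q i k‖ ^ 2 ≤ (n * μ) * ‖(Uᴴ *ᵥ q) k‖ ^ 2 := by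
    intro k
    rw [sampleTerm, norm_mul, norm_mul, mul_pow, mul_pow, Complex.norm_natCast]
    have := h.right_entry i k
    calc (n : ℝ) ^ 2 * (‖V i k‖ ^ 2 * ‖(Uᴴ *ᵥ q) k‖ ^ 2)
        = n * (n * ‖V i k‖ ^ 2) * ‖(Uᴴ *ᵥ q) k‖ ^ 2 := by ring
      _ ≤ _ := by gcongr
  calc 𝔼 k, ‖sampleTerm U V q i k‖ ^ 2 ≤ 𝔼 k, (n * μ) * ‖(Uᴴ *ᵥ q) k‖ ^ 2 := expect_mono h1
    _ = μ * nsq (Uᴴ *ᵥ q) := by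
        rw [← Finset.mul_expect, Fintype.expect_eq_sum_div_card, nsq, Fintype.card_fin]
        field_simp
    _ ≤ μ * (2 * nsq q) := by gcongr; exact h.bound q
    _ = _ := by ring

theorem norm_adjoint_mulVec_sq_le (hU : ∀ i k, n * ‖U i k‖ ^ 2 ≤ μ) {J : Finset (Fin N)}
    {q : Fin N → ℂ} (hq : ∀ i, i ∉ J → q i = 0) (k : Fin n) :
    n * ‖(Uᴴ *ᵥ q) k‖ ^ 2 ≤ J.card * μ * nsq q := by
  have h1 : (Uᴴ *ᵥ q) k = ∑ i ∈ J, star (U i k) * q i := by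
    rw [Matrix.mulVec, dotProduct]
    refine (Finset.sum_subset (Finset.subset_univ J) fun i _ hi => ?_).symm
    simp [hq i hi]
  have h2 := norm_sum_mul_sq_le J (fun i => star (U i k)) q
  rw [← h1] at h2
  have h3 : ∑ i ∈ J, ‖q i‖ ^ 2 ≤ nsq q :=
    Finset.sum_le_sum_of_subset_of_nonneg (Finset.subset_univ J) fun _ _ _ => by positivity
  have h4 : n * ∑ i ∈ J, ‖star (U i k)‖ ^ 2 ≤ J.card * μ := by
    rw [Finset.mul_sum, ← nsmul_eq_mul]
    refine Finset.sum_le_card_nsmul _ _ _ fun i _ => ?_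
    simpa using hU i k
  calc n * ‖(Uᴴ *ᵥ q) k‖ ^ 2
      ≤ n * ((∑ i ∈ J, ‖star (U i k)‖ ^ 2) * ∑ i ∈ J, ‖q i‖ ^ 2) := by gcongr
    _ = (n * ∑ i ∈ J, ‖star (U i k)‖ ^ 2) * ∑ i ∈ J, ‖q i‖ ^ 2 := by ring
    _ ≤ (J.card * μ) * nsq q := by
        gcongr
        exact le_trans (by positivity) h4

theorem norm_sampleTerm_sq_le (h : IsIncoherentPair U V μ M) {J : Finset (Fin N)}
    {q : Fin N → ℂ} (hq : ∀ i, i ∉ J → q i = 0) (i : Fin N) (k : Fin n) :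
    ‖sampleTerm U V q i k‖ ^ 2 ≤ μ ^ 2 * (J.card * nsq q) := by
  have h1 := norm_adjoint_mulVec_sq_le h.left_entry hq k
  have hμ := h.nonneg i k
  rw [sampleTerm, norm_mul, norm_mul, mul_pow, mul_pow, Complex.norm_natCast]
  calc (n : ℝ) ^ 2 * (‖V i k‖ ^ 2 * ‖(Uᴴ *ᵥ q) k‖ ^ 2)
      = (n * ‖V i k‖ ^ 2) * (n * ‖(Uᴴ *ᵥ q) k‖ ^ 2) := by ring
    _ ≤ μ * (J.card * μ * nsq q) := by gcongr; exact h.right_entry i k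
    _ = _ := by ring

theorem expect_norm_fluctuation_sq_le [NeZero n] (h : IsIncoherentPair U V μ M) {m : ℕ}
    (hm : 0 < m) (q : Fin N → ℂ) (i : Fin N) :
    𝔼 b : Fin m → Fin n, ‖fluctuation U V b q i‖ ^ 2 ≤ 2 * μ / m * nsq q := by
  refine (expect_norm_sq_average_sub_le _ hm).trans ?_
  calc (1 / m : ℝ) * 𝔼 k, ‖sampleTerm U V q i k‖ ^ 2 ≤ (1 / m : ℝ) * (2 * μ * nsq q) := by
        gcongr; exact expect_norm_sampleTerm_sq_le h q i
    _ = _ := by ring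

/-- A Bernstein-type bound: `hstep` keeps each scaled, centred summand at most `1` in absolute
value, so `expect_exp_le` applies to each draw and the exponent is the variance. -/
theorem expect_exp_fluctuation_le [NeZero n] (h : IsIncoherentPair U V μ M) {m : ℕ}
    (hm : 0 < m) {J : Finset (Fin N)} {q : Fin N → ℂ} (hq : ∀ i, i ∉ J → q i = 0) {a lam : ℝ}
    (hlam : 0 ≤ lam) (ha : nsq q ≤ J.card * a)
    (hstep : (lam * (2 * μ * J.card)) ^ 2 * a ≤ m ^ 2) (i : Fin N) {ζ : ℂ} (hζ : ‖ζ‖ = 1) :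
    𝔼 b : Fin m → Fin n, Real.exp (lam * (ζ * fluctuation U V b q i).re)
      ≤ Real.exp (lam ^ 2 * (2 * μ * J.card) * a / m) := by
  have hμ := h.nonneg i 0
  have hm' : (0 : ℝ) < m := by exact_mod_cast hm
  set ξ := sampleTerm U V q i with hξ
  set e := 𝔼 k, ξ k with he
  set g : Fin n → ℝ := fun k => lam / m * (ζ * (ξ k - e)).re with hg
  have hsum : ∀ b : Fin m → Fin n,
      lam * (ζ * fluctuation U V b q i).re = ∑ j, g (b j) := by
    intro b
    have h1 : fluctuation U V b q i = ((1 / m : ℝ) : ℂ) * ∑ j, (ξ (b j) - e) := by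
      rw [fluctuation, Finset.sum_sub_distrib]
      have : (m : ℂ) ≠ 0 := by exact_mod_cast hm.ne'
      simp
      field_simp
      rfl
    rw [h1, hg, ← Finset.mul_sum, ← Complex.re_sum, ← Finset.mul_sum, mul_left_comm,
      Complex.re_ofReal_mul]
    ring
  have hmean : 𝔼 k, g k = 0 := by
    rw [hg, ← Finset.mul_expect, ← expect_re, ← Finset.mul_expect, Finset.expect_sub_distrib,
      ← he, Fintype.expect_const]
    simp
  have hξb : ∀ k, ‖ξ k‖ ≤ μ * J.card * √a := by
    intro k
    have h1 := norm_sampleTerm_sq_le h hq i k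
    have ha0 : 0 ≤ J.card * a := (nsq_nonneg q).trans ha
    -- The hypothesis `ha` forces `a ≥ 0` only when `J` is nonempty.
    rcases Nat.eq_zero_or_pos J.card with h0 | h0
    · have : ‖ξ k‖ ^ 2 ≤ 0 := by simpa [h0] using h1
      have : ‖ξ k‖ = 0 := by nlinarith [norm_nonneg (ξ k)]
      simp [this, h0]
    · have hc : (0 : ℝ) < J.card := by exact_mod_cast h0
      have ha1 : 0 ≤ a := nonneg_of_mul_nonneg_right ha0 hc
      refine abs_le_of_sq_le_sq' ?_ (by positivity) |>.2
      rw [mul_pow, Real.sq_sqrt ha1]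
      refine h1.trans ?_
      calc μ ^ 2 * (J.card * nsq q) ≤ μ ^ 2 * (J.card * (J.card * a)) := by gcongr
        _ = _ := by ring
  have heb : ‖e‖ ≤ μ * J.card * √a := by
    rw [he, Fintype.expect_eq_sum_div_card, norm_div]
    have hn : (0 : ℝ) < n := by exact_mod_cast Nat.pos_of_neZero n
    simp only [Fintype.card_fin, Complex.norm_natCast]
    rw [div_le_iff₀ hn]
    refine (norm_sum_le_of_le _ fun k _ => hξb k).trans ?_
    simp [mul_comm]
  have hre : ∀ z : ℂ, |(ζ * z).re| ≤ ‖z‖ := fun z => by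
    simpa [hζ] using Complex.abs_re_le_norm (ζ * z)
  have hg1 : ∀ k, |g k| ≤ 1 := by
    intro k
    have h1 : ‖ξ k - e‖ ≤ 2 * μ * J.card * √a := by
      refine (norm_sub_le _ _).trans ?_
      linarith [hξb k]
    have h2 : lam * (2 * μ * J.card) * √a ≤ m := by
      rcases le_total 0 a with h0 | h0
      · refine abs_le_of_sq_le_sq' ?_ hm'.le |>.2
        rw [mul_pow, Real.sq_sqrt h0]
        exact hstep
      · rw [Real.sqrt_eq_zero_of_nonpos h0]
        simp
    rw [hg, abs_mul, abs_of_nonneg (by positivity : 0 ≤ lam / m), div_mul_eq_mul_div,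
      div_le_one hm']
    calc lam * |(ζ * (ξ k - e)).re| ≤ lam * (2 * μ * J.card * √a) := by
          gcongr
          exact (hre _).trans h1
      _ ≤ m := by linarith
  have hvar : 𝔼 k, g k ^ 2 ≤ (lam / m) ^ 2 * ((2 * μ * J.card) * a) := by
    calc 𝔼 k, g k ^ 2 ≤ 𝔼 k, (lam / m) ^ 2 * ‖ξ k - e‖ ^ 2 := by
          refine expect_mono fun k => ?_
          rw [hg, mul_pow, ← sq_abs (Complex.re _)]
          gcongr
          exact hre _
      _ ≤ (lam / m) ^ 2 * 𝔼 k, ‖ξ k‖ ^ 2 := by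
          rw [← Finset.mul_expect]
          exact mul_le_mul_of_nonneg_left (expect_norm_sq_sub_le ξ) (by positivity)
      _ ≤ (lam / m) ^ 2 * (2 * μ * (J.card * a)) := by
          gcongr
          refine (expect_norm_sampleTerm_sq_le h q i).trans ?_
          gcongr
      _ = _ := by ring
  simp only [hsum]
  rw [expect_exp_sum]
  calc (𝔼 k, Real.exp (g k)) ^ m
      ≤ Real.exp ((lam / m) ^ 2 * ((2 * μ * J.card) * a)) ^ m := by
        have h0 : 0 ≤ 𝔼 k, Real.exp (g k) := expect_nonneg' fun k => (Real.exp_pos _).le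
        gcongr
        exact (expect_exp_le g hmean hg1).trans (Real.exp_le_exp.2 hvar)
    _ = _ := by
        rw [← Real.exp_nat_mul]
        congr 1
        field_simp

end Batch

/-- The index type of the samples in the first batches, where batch `r` has `m r` samples. -/
def SampleIdx (m : ℕ → ℕ) : ℕ → Type
  | 0 => Empty
  | l + 1 => SampleIdx m l ⊕ Fin (m l)

instance SampleIdx.instFintype (m : ℕ → ℕ) : ∀ l, Fintype (SampleIdx m l)
  | 0 => inferInstanceAs (Fintype Empty)
  | l + 1 =>
    letI := SampleIdx.instFintype m l
    inferInstanceAs (Fintype (SampleIdx m l ⊕ Fin (m l)))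

instance SampleIdx.instDecidableEq (m : ℕ → ℕ) : ∀ l, DecidableEq (SampleIdx m l)
  | 0 => inferInstanceAs (DecidableEq Empty)
  | l + 1 =>
    letI := SampleIdx.instDecidableEq m l
    inferInstanceAs (DecidableEq (SampleIdx m l ⊕ Fin (m l)))

instance SampleIdx.instIsEmpty (m : ℕ → ℕ) : IsEmpty (SampleIdx m 0) :=
  inferInstanceAs (IsEmpty Empty)

theorem SampleIdx.card (m : ℕ → ℕ) (l : ℕ) :
    Fintype.card (SampleIdx m l) = ∑ r ∈ Finset.range l, m r := by
  induction l with
  | zero => rw [Finset.range_zero, Finset.sum_empty]; exact Fintype.card_eq_zero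
  | succ l ih =>
    rw [Finset.sum_range_succ, ← ih]
    exact (Fintype.card_sum (α := SampleIdx m l) (β := Fin (m l))).trans (by simp)

/-! ### The golfing scheme: residuals, certificates and their bounds -/

section Golfing

variable {n N : ℕ} {m : ℕ → ℕ}

/-- The samples of all batches but the last one. -/
def init {l : ℕ} (p : SampleIdx m (l + 1) → Fin n) : SampleIdx m l → Fin n :=
  fun j => p (Sum.inl j)

/-- The samples of the last batch. -/
def last {l : ℕ} (p : SampleIdx m (l + 1) → Fin n) : Fin (m l) → Fin n :=
  fun j => p (Sum.inr j)

theorem expect_sampleIdx_succ {l : ℕ}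
    (f : (SampleIdx m l → Fin n) → (Fin (m l) → Fin n) → ℝ) :
    𝔼 p : SampleIdx m (l + 1) → Fin n, f (init p) (last p) = 𝔼 a, 𝔼 b, f a b :=
  expect_sum_arrow (ι := SampleIdx m l) (κ := Fin (m l))
    (fun p : SampleIdx m l ⊕ Fin (m l) → Fin n => f (p ∘ Sum.inl) (p ∘ Sum.inr))

variable (U V : Matrix (Fin N) (Fin n) ℂ) (J : Finset (Fin N))

/-- The residual of the golfing scheme on the support `J`. -/
noncomputable def residual (q : Fin N → ℂ) :
    ∀ l, (SampleIdx m l → Fin n) → Fin N → ℂ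
  | 0, _ => q
  | l + 1, p => fun i =>
    if i ∈ J then -fluctuation U V (last p) (residual q l (init p)) i else 0

/-- The dual certificate that the golfing scheme builds. -/
noncomputable def certificate (q : Fin N → ℂ) :
    ∀ l, (SampleIdx m l → Fin n) → Fin N → ℂ
  | 0, _ => 0
  | l + 1, p => certificate q l (init p) + (residual U V J q l (init p)
      + fluctuation U V (last p) (residual U V J q l (init p)))

variable {U V J} {μ M : ℝ}

theorem residual_eq_zero {q : Fin N → ℂ} (hq : ∀ i, i ∉ J → q i = 0) {l : ℕ}
    (p : SampleIdx m l → Fin n) {i : Fin N} (hi : i ∉ J) : residual U V J q l p i = 0 := by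
  cases l with
  | zero => exact hq i hi
  | succ l => simp [residual, hi]

/-- On `J` the new residual cancels the fluctuation just added to the certificate, so the sum is
invariant. -/
theorem certificate_add_residual (q : Fin N → ℂ) {l : ℕ} (p : SampleIdx m l → Fin n)
    {i : Fin N} (hi : i ∈ J) :
    certificate U V J q l p i + residual U V J q l p i = q i := by
  induction l with
  | zero => simp [certificate, residual]
  | succ l ih =>
    rw [← ih (init p)]
    simp only [certificate, residual, hi, if_true, Pi.add_apply]
    ring

/-- The mean of the sample terms is `V Uᴴ q`, and `Uᴴ V = 1` makes its image under `Uᴴ` cancel `Uᴴ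
q`. What remains is a combination of the basis vectors at the sampled indices. -/
theorem adjoint_mulVec_add_fluctuation [NeZero n] (h : IsIncoherentPair U V μ M) {r : ℕ}
    (b : Fin r → Fin n) (q : Fin N → ℂ) {k : Fin n} (hk : k ∉ Set.range b) :
    (Uᴴ *ᵥ (q + fluctuation U V b q)) k = 0 := by
  set c := Uᴴ *ᵥ q with hc
  have hn : (n : ℂ) ≠ 0 := by exact_mod_cast NeZero.ne n
  have h1 : fluctuation U V b q
      = (n / r : ℂ) • ∑ j, c (b j) • V.col (b j) - V *ᵥ c := by
    ext i
    simp only [fluctuation, sampleTerm, Pi.sub_apply, Pi.smul_apply, Finset.sum_apply,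
      smul_eq_mul, Matrix.col_apply, Fintype.expect_eq_sum_div_card, Fintype.card_fin,
      Matrix.mulVec, dotProduct, ← Finset.mul_sum]
    rw [mul_div_cancel_left₀ _ hn]
    congr 1
    rw [← mul_assoc]
    congr 1
    · ring
    · exact Finset.sum_congr rfl fun j _ => mul_comm _ _
  have h2 : ∀ j, (Uᴴ *ᵥ V.col j) k = (1 : Matrix (Fin n) (Fin n) ℂ) k j := by
    intro j
    rw [← h.dual']
    rfl
  rw [h1, Matrix.mulVec_add, Matrix.mulVec_sub, Matrix.mulVec_mulVec, h.dual', Matrix.one_mulVec,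
    Matrix.mulVec_smul, Matrix.mulVec_sum]
  simp only [Matrix.mulVec_smul, Pi.add_apply, Pi.sub_apply, Pi.smul_apply, Finset.sum_apply, h2]
  rw [Finset.sum_eq_zero]
  · simp [hc]
  · intro j _
    have : k ≠ b j := fun e => hk ⟨j, e.symm⟩
    simp [Matrix.one_apply_ne this]

theorem adjoint_mulVec_certificate [NeZero n] (h : IsIncoherentPair U V μ M) (q : Fin N → ℂ)
    {l : ℕ} (p : SampleIdx m l → Fin n) {k : Fin n} (hk : k ∉ Set.range p) :
    (Uᴴ *ᵥ certificate U V J q l p) k = 0 := by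
  induction l with
  | zero => simp [certificate]
  | succ l ih =>
    rw [certificate, Matrix.mulVec_add, Pi.add_apply,
      ih (init p) fun ⟨j, hj⟩ => hk ⟨Sum.inl j, hj⟩,
      adjoint_mulVec_add_fluctuation h (last p) _ fun ⟨j, hj⟩ => hk ⟨Sum.inr j, hj⟩, add_zero]

/-- With the earlier batches fixed, each of the `J.card` coordinates of the new residual has second
moment at most `2μ / m l` times the old squared norm. -/
theorem expect_nsq_residual_le [NeZero n] (h : IsIncoherentPair U V μ M) (hμ : 0 ≤ μ)
    (hm : ∀ l, 0 < m l) (q : Fin N → ℂ) (l : ℕ) :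
    𝔼 p : SampleIdx m l → Fin n, nsq (residual U V J q l p)
      ≤ (∏ r ∈ Finset.range l, 2 * μ * J.card / m r) * nsq q := by
  induction l with
  | zero => simp [residual]
  | succ l ih =>
    have h1 : ∀ p : SampleIdx m (l + 1) → Fin n, nsq (residual U V J q (l + 1) p)
        = ∑ i ∈ J, ‖fluctuation U V (last p) (residual U V J q l (init p)) i‖ ^ 2 := by
      intro p
      rw [nsq, ← Finset.sum_subset (Finset.subset_univ J)]
      · refine Finset.sum_congr rfl fun i hi => ?_
        simp [residual, hi]
      · intro i _ hi
        simp [residual, hi]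
    simp only [h1]
    rw [expect_sampleIdx_succ (fun a b =>
      ∑ i ∈ J, ‖fluctuation U V b (residual U V J q l a) i‖ ^ 2)]
    calc _ ≤ 𝔼 a : SampleIdx m l → Fin n,
          2 * μ * J.card / m l * nsq (residual U V J q l a) := by
          refine expect_mono fun a => ?_
          rw [Finset.expect_sum_comm]
          refine (Finset.sum_le_card_nsmul J _ _ fun i _ =>
            expect_norm_fluctuation_sq_le h (hm l) _ i).trans_eq ?_
          rw [nsmul_eq_mul]
          ring
      _ ≤ 2 * μ * J.card / m l * ((∏ r ∈ Finset.range l, 2 * μ * J.card / m r) * nsq q) := by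
          rw [← Finset.mul_expect]
          gcongr
      _ = _ := by
          rw [Finset.prod_range_succ]
          ring

/-- The predicates `Q r`, for `r < l`, hold for the samples of the first `r` batches. -/
def Always (Q : ∀ l, (SampleIdx m l → Fin n) → Prop) : ∀ l, (SampleIdx m l → Fin n) → Prop
  | 0, _ => True
  | l + 1, p => Always Q l (init p) ∧ Q l (init p)

theorem frac_not_always_le [NeZero n] (Q : ∀ l, (SampleIdx m l → Fin n) → Prop) (l : ℕ) :
    frac (fun p => ¬ Always Q l p) ≤ ∑ r ∈ Finset.range l, frac fun p => ¬ Q r p := by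
  classical
  induction l with
  | zero => simp [Always, frac]
  | succ l ih =>
    have h1 : ∀ R : (SampleIdx m l → Fin n) → Prop,
        frac (fun p : SampleIdx m (l + 1) → Fin n => R (init p)) = frac R := by
      intro R
      rw [frac, frac, expect_sampleIdx_succ (fun a _ => if R a then 1 else 0)]
      exact Finset.expect_congr rfl fun a _ => Fintype.expect_const _
    rw [Finset.sum_range_succ, ← h1 fun p => ¬ Q l p]
    refine le_trans ?_ (add_le_add_left ih _)
    rw [← h1 fun p => ¬ Always Q l p]
    refine le_trans (frac_mono fun p hp => ?_) (frac_or_le _ _)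
    simp only [Always] at hp
    tauto

open Classical in
-- Off `J` the residual vanishes, so each batch adds only its fluctuation. The event at stage `l +
-- 1` depends only on the earlier batches, so the last batch can be averaged first, with the
-- residual bound available.
theorem expect_exp_certificate_le [NeZero n] (h : IsIncoherentPair U V μ M) (hm : ∀ l, 0 < m l)
    {q : Fin N → ℂ} (hq : ∀ i, i ∉ J → q i = 0) {Q : ∀ l, (SampleIdx m l → Fin n) → Prop}
    {a : ℕ → ℝ} (hQ : ∀ l p, Q l p → nsq (residual U V J q l p) ≤ J.card * a l)
    {lam : ℝ} (hlam : 0 ≤ lam)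
    (hstep : ∀ l, (lam * (2 * μ * J.card)) ^ 2 * a l ≤ m l ^ 2) {i : Fin N} (hi : i ∉ J) {ζ : ℂ}
    (hζ : ‖ζ‖ = 1) (l : ℕ) :
    𝔼 p : SampleIdx m l → Fin n,
        (if Always Q l p then Real.exp (lam * (ζ * certificate U V J q l p i).re) else 0)
      ≤ Real.exp (∑ r ∈ Finset.range l, lam ^ 2 * (2 * μ * J.card) * a r / m r) := by
  induction l with
  | zero => simp [Always, certificate]
  | succ l ih =>
    have h1 : ∀ p : SampleIdx m (l + 1) → Fin n,
        (if Always Q (l + 1) p then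
          Real.exp (lam * (ζ * certificate U V J q (l + 1) p i).re) else 0)
        = (if Always Q l (init p) ∧ Q l (init p) then
          Real.exp (lam * (ζ * certificate U V J q l (init p) i).re)
            * Real.exp (lam * (ζ * fluctuation U V (last p)
                (residual U V J q l (init p)) i).re) else 0) := by
      intro p
      have : certificate U V J q (l + 1) p i = certificate U V J q l (init p) i
          + fluctuation U V (last p) (residual U V J q l (init p)) i := by
        simp [certificate, residual_eq_zero hq _ hi]
      rw [this, mul_add, Complex.add_re, mul_add, Real.exp_add]
      exact if_congr Iff.rfl rfl rfl
    simp only [h1]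
    rw [expect_sampleIdx_succ (fun a b => if Always Q l a ∧ Q l a then
          Real.exp (lam * (ζ * certificate U V J q l a i).re)
            * Real.exp (lam * (ζ * fluctuation U V b (residual U V J q l a) i).re) else 0)]
    calc _ ≤ 𝔼 p : SampleIdx m l → Fin n,
          (if Always Q l p then Real.exp (lam * (ζ * certificate U V J q l p i).re) else 0)
            * Real.exp (lam ^ 2 * (2 * μ * J.card) * a l / m l) := by
          refine expect_mono fun p => ?_
          by_cases hp : Always Q l p
          · by_cases hp' : Q l p
            · simp only [hp, hp', and_self, if_true]
              rw [← Finset.mul_expect]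
              gcongr
              exact expect_exp_fluctuation_le h (hm l) (fun i => residual_eq_zero hq p) hlam
                (hQ l p hp') (hstep l) i hζ
            · simp only [hp', and_false, if_false]
              rw [Finset.expect_const_zero]
              positivity
          · simp [hp]
      _ ≤ _ := by
          rw [← Finset.expect_mul, Finset.sum_range_succ, Real.exp_add]
          gcongr

/-- Markov's inequality at level `e^{lam/4}` against an exponent of at most `lam/8` leaves
`e^{-lam/8}` for each of four directions. -/
theorem frac_lt_norm_certificate_le [NeZero n] (h : IsIncoherentPair U V μ M)
    (hm : ∀ l, 0 < m l) {q : Fin N → ℂ} (hq : ∀ i, i ∉ J → q i = 0)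
    {Q : ∀ l, (SampleIdx m l → Fin n) → Prop}
    {a : ℕ → ℝ} (hQ : ∀ l p, Q l p → nsq (residual U V J q l p) ≤ J.card * a l)
    {lam : ℝ} (hlam : 0 ≤ lam)
    (hstep : ∀ l, (lam * (2 * μ * J.card)) ^ 2 * a l ≤ m l ^ 2) {i : Fin N} (hi : i ∉ J)
    (l : ℕ)
    (hsum : ∑ r ∈ Finset.range l, lam ^ 2 * (2 * μ * J.card) * a r / m r ≤ lam / 8) :
    frac (fun p : SampleIdx m l → Fin n =>
        Always Q l p ∧ 1 / 2 < ‖certificate U V J q l p i‖) ≤ 4 * Real.exp (-(lam / 8)) := by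
  classical
  have key : ∀ ζ : ℂ, ‖ζ‖ = 1 → frac (fun p : SampleIdx m l → Fin n =>
      Always Q l p ∧ 1 / 4 < (ζ * certificate U V J q l p i).re) ≤ Real.exp (-(lam / 8)) := by
    intro ζ hζ
    have h1 := expect_exp_certificate_le h hm hq hQ hlam hstep hi hζ l
    refine (frac_le_of_le (Real.exp_pos (lam / 4)) (f := fun p : SampleIdx m l → Fin n =>
        if Always Q l p then Real.exp (lam * (ζ * certificate U V J q l p i).re) else 0)
        (fun p => by positivity) fun p hp => ?_).trans ?_
    · simp only [hp.1, if_true]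
      refine Real.exp_le_exp.2 ?_
      nlinarith [hp.2]
    · rw [div_le_iff₀ (Real.exp_pos _), ← Real.exp_add]
      refine h1.trans (Real.exp_le_exp.2 ?_)
      linarith
  have h2 : frac (fun p : SampleIdx m l → Fin n =>
        Always Q l p ∧ 1 / 2 < ‖certificate U V J q l p i‖)
      ≤ frac (fun p : SampleIdx m l → Fin n => ∃ t : Fin 4,
        Always Q l p ∧ 1 / 4 < (Complex.I ^ (t : ℕ) * certificate U V J q l p i).re) := by
    refine frac_mono fun p hp => ?_
    -- If the real parts in the directions `1, i, -1, -i` are all at most `1/4`, the squared norm is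
    -- at most `1/8 < 1/4`.
    by_contra hcon
    push Not at hcon
    have e0 := hcon 0 hp.1
    have e1 := hcon 1 hp.1
    have e2 := hcon 2 hp.1
    have e3 := hcon 3 hp.1
    have i3 : Complex.I ^ 3 = -Complex.I := by
      rw [pow_succ, Complex.I_sq]; ring
    simp [i3] at e0 e1 e2 e3
    have hn : ‖certificate U V J q l p i‖ ^ 2 ≤ 1 / 8 := by
      rw [← Complex.normSq_eq_norm_sq, Complex.normSq_apply]
      nlinarith
    nlinarith [hp.2]
  refine h2.trans ((frac_exists_le _).trans ?_)
  refine (Finset.sum_le_card_nsmul _ _ _ fun t _ => key _ (by simp)).trans_eq ?_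
  simp

/-- A crude bound valid for every choice of samples: both the batch average and the mean are at most
`n M ‖q‖₂`. It is the source of the `log M` in the sample count. -/
theorem norm_fluctuation_le (h : IsIncoherentPair U V μ M) (hM : 0 ≤ M) {r : ℕ}
    (b : Fin r → Fin n) (q : Fin N → ℂ) (i : Fin N) :
    ‖fluctuation U V b q i‖ ≤ 2 * n * M * √(nsq q) := by
  have h1 : ∀ k, ‖sampleTerm U V q i k‖ ≤ n * M * √(nsq q) := by
    intro k
    have h2 : ‖(Uᴴ *ᵥ q) k‖ ^ 2 ≤ nsq (U.col k) * nsq q := by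
      have := norm_sum_mul_sq_le Finset.univ (fun i => star (U i k)) q
      simp only [norm_star] at this
      exact this
    have h3 : ‖V i k‖ ^ 2 ≤ nsq (V.col k) := norm_sq_le_nsq (V.col k) i
    have h4 : ‖V i k * (Uᴴ *ᵥ q) k‖ ≤ M * √(nsq q) := by
      refine abs_le_of_sq_le_sq' ?_ (by positivity) |>.2
      rw [norm_mul, mul_pow, mul_pow, Real.sq_sqrt (nsq_nonneg q)]
      calc ‖V i k‖ ^ 2 * ‖(Uᴴ *ᵥ q) k‖ ^ 2
          ≤ nsq (V.col k) * (nsq (U.col k) * nsq q) := by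
            gcongr
            exact nsq_nonneg _
        _ = (nsq (U.col k) * nsq (V.col k)) * nsq q := by ring
        _ ≤ M ^ 2 * nsq q := mul_le_mul_of_nonneg_right (h.col_bound k) (nsq_nonneg q)
    rw [sampleTerm, norm_mul, Complex.norm_natCast, mul_assoc]
    gcongr
  have hB : 0 ≤ n * M * √(nsq q) := by positivity
  have h5 : ‖(1 / r : ℂ) * ∑ j, sampleTerm U V q i (b j)‖ ≤ n * M * √(nsq q) := by
    rcases Nat.eq_zero_or_pos r with rfl | hr
    · simpa using hB
    · have hr' : (0 : ℝ) < r := by exact_mod_cast hr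
      rw [norm_mul]
      have := norm_sum_le_of_le Finset.univ fun j _ => h1 (b j)
      simp only [Finset.sum_const, Finset.card_univ, Fintype.card_fin, nsmul_eq_mul] at this
      calc _ ≤ (1 / r : ℝ) * (r * (n * M * √(nsq q))) := by
            gcongr
            simp
        _ = _ := by field_simp
  have h6 : ‖𝔼 k, sampleTerm U V q i k‖ ≤ n * M * √(nsq q) := by
    rcases Nat.eq_zero_or_pos n with rfl | hn
    · simp
    · have hn' : (0 : ℝ) < n := by exact_mod_cast hn
      rw [Fintype.expect_eq_sum_div_card, norm_div]
      simp only [Fintype.card_fin, Complex.norm_natCast]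
      rw [div_le_iff₀ hn']
      refine (norm_sum_le_of_le _ fun k _ => h1 k).trans ?_
      simp [mul_comm]
  refine (norm_sub_le _ _).trans ?_
  linarith

theorem norm_certificate_le (h : IsIncoherentPair U V μ M) (hM : 0 ≤ M) {q : Fin N → ℂ}
    {Q : ∀ l, (SampleIdx m l → Fin n) → Prop} {B : ℕ → ℝ}
    (hQ : ∀ l p, Q l p → √(nsq (residual U V J q l p)) ≤ B l) {l : ℕ}
    (p : SampleIdx m l → Fin n) (hp : Always Q l p) (i : Fin N) :
    ‖certificate U V J q l p i‖ ≤ (1 + 2 * n * M) * ∑ r ∈ Finset.range l, B r := by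
  induction l with
  | zero => simp [certificate]
  | succ l ih =>
    have h1 := ih (init p) hp.1
    have h2 := hQ l (init p) hp.2
    have h3 := norm_fluctuation_le h hM (last p) (residual U V J q l (init p)) i
    have h4 : ‖residual U V J q l (init p) i‖ ≤ √(nsq (residual U V J q l (init p))) :=
      Real.le_sqrt_of_sq_le (norm_sq_le_nsq _ i)
    rw [Finset.sum_range_succ, certificate]
    refine (norm_add_le _ _).trans ?_
    have h5 := norm_add_le (residual U V J q l (init p) i)
      (fluctuation U V (last p) (residual U V J q l (init p)) i)
    have h6 : 2 * n * M * √(nsq (residual U V J q l (init p))) ≤ 2 * n * M * B l := by gcongr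
    simp only [Pi.add_apply]
    linarith

end Golfing

/-! ### Recovery from approximate dual certificates -/

section Recovery

variable {n N : ℕ}

/-- Every perturbation of `x` that vanishes on `S` increases the `ℓ_1` norm after the transform. -/
def IsStrictMinimizer (U : Matrix (Fin N) (Fin n) ℂ) (x : Fin n → ℂ) (S : Set (Fin n)) : Prop :=
  ∀ h : Fin n → ℂ, (∀ k ∈ S, h k = 0) → h ≠ 0 → l1Norm (U *ᵥ x) < l1Norm (U *ᵥ (x + h))

theorem IsStrictMinimizer.mono {U : Matrix (Fin N) (Fin n) ℂ} {x : Fin n → ℂ}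
    {S S' : Set (Fin n)} (h : IsStrictMinimizer U x S) (hS : S ⊆ S') :
    IsStrictMinimizer U x S' :=
  fun g hg => h g fun k hk => hg k (hS hk)

theorem IsStrictMinimizer.isRecovered {m : ℕ} {U : Matrix (Fin N) (Fin n) ℂ} {x : Fin n → ℂ}
    {idx : Fin m → Fin n} (h : IsStrictMinimizer U x (Set.range idx)) : IsRecovered U x idx := by
  have key : ∀ g : Fin n → ℂ, sample idx g = sample idx x → g ≠ x →
      l1Norm (U *ᵥ x) < l1Norm (U *ᵥ g) := by
    intro g hg hne
    have := h (g - x) (by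
      rintro _ ⟨j, rfl⟩
      have := congrFun hg j
      simp only [sample] at this
      simp [this]) (sub_ne_zero.2 hne)
    simpa using this
  refine ⟨rfl, fun g hg => ?_, fun g hg hmin => ?_⟩
  · by_cases hne : g = x
    · exact (congrArg (fun v => l1Norm (U *ᵥ v)) hne).ge
    · exact (key g hg hne).le
  · by_contra hne
    exact (key g hg hne).not_ge (hmin (show x ∈ {g | sample idx g = sample idx x} from rfl))

theorem star_dotProduct_mulVec_eq_zero {U : Matrix (Fin N) (Fin n) ℂ} {S : Set (Fin n)}
    {w : Fin N → ℂ} (hw : ∀ k, k ∉ S → (Uᴴ *ᵥ w) k = 0) {h : Fin n → ℂ}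
    (hh : ∀ k ∈ S, h k = 0) : ∑ i, star (w i) * (U *ᵥ h) i = 0 := by
  have h1 : star w ⬝ᵥ (U *ᵥ h) = star (Uᴴ *ᵥ w) ⬝ᵥ h := by
    rw [Matrix.star_mulVec, Matrix.conjTranspose_conjTranspose, Matrix.dotProduct_mulVec]
  refine h1.trans (Finset.sum_eq_zero fun k _ => ?_)
  by_cases hk : k ∈ S
  · simp [hh k hk]
  · simp [hw k hk]

/-- Orthogonality moves the pairing with `w` from `J` to its complement. The defect `r` is paid in
`ℓ₂` on `J`, and `w` in `ℓ_∞` off `J`. -/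
theorem norm_sum_star_mul_le {J : Finset (Fin N)} {w r t y : Fin N → ℂ} {G : ℝ}
    (hy : ∑ i, star (w i) * y i = 0) (ht : ∀ i ∈ J, w i + r i = t i)
    (hG : ∀ i, i ∉ J → ‖w i‖ ≤ G) :
    ‖∑ i ∈ J, star (t i) * y i‖
      ≤ √(nsq r) * √(∑ i ∈ J, ‖y i‖ ^ 2) + G * ∑ i ∈ Jᶜ, ‖y i‖ := by
  have h1 : ∑ i ∈ J, star (t i) * y i
      = ∑ i ∈ J, star (r i) * y i - ∑ i ∈ Jᶜ, star (w i) * y i := by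
    have h2 := Finset.sum_add_sum_compl J fun i => star (w i) * y i
    rw [hy] at h2
    have h3 : ∑ i ∈ J, star (t i) * y i
        = ∑ i ∈ J, star (w i) * y i + ∑ i ∈ J, star (r i) * y i := by
      rw [← Finset.sum_add_distrib]
      refine Finset.sum_congr rfl fun i hi => ?_
      rw [← ht i hi, star_add]
      ring
    rw [h3]
    linear_combination h2
  have h4 : ‖∑ i ∈ J, star (r i) * y i‖ ≤ √(nsq r) * √(∑ i ∈ J, ‖y i‖ ^ 2) := by
    rw [← Real.sqrt_mul (nsq_nonneg r)]
    refine Real.le_sqrt_of_sq_le ((norm_sum_mul_sq_le J (fun i => star (r i)) y).trans ?_)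
    simp only [norm_star]
    gcongr
    exact Finset.sum_le_sum_of_subset_of_nonneg (Finset.subset_univ J) fun _ _ _ => by positivity
  have h5 : ‖∑ i ∈ Jᶜ, star (w i) * y i‖ ≤ G * ∑ i ∈ Jᶜ, ‖y i‖ := by
    rw [Finset.mul_sum]
    refine norm_sum_le_of_le _ fun i hi => ?_
    rw [norm_mul, norm_star]
    gcongr
    exact hG i (Finset.mem_compl.1 hi)
  rw [h1]
  exact (norm_sub_le _ _).trans (add_le_add h4 h5)

/-- The entrywise sign of a complex vector. -/
noncomputable def signVec (z : Fin N → ℂ) : Fin N → ℂ := fun i => z i / ‖z i‖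

/-- The basis certificates `W i` bound `y = Uh` on `J` by `Γ` times its `ℓ₁` mass `τ` off `J`, up to
a small multiple of itself. The sign certificate then loses at most `3τ/4` on `J`, while the
complement gains `τ`. The constant `Γ` may be large, since only `ε Γ` must be small. -/
theorem isStrictMinimizer_of_certificates {U : Matrix (Fin N) (Fin n) ℂ}
    (hU : Function.Injective fun g : Fin n → ℂ => U *ᵥ g) {x : Fin n → ℂ} {S : Set (Fin n)}
    {J : Finset (Fin N)} (hJ : ∀ i, i ∈ J ↔ (U *ᵥ x) i ≠ 0)
    {w r : Fin N → ℂ} {W R : Fin N → Fin N → ℂ} {ε η Γ : ℝ}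
    (hw : ∀ k, k ∉ S → (Uᴴ *ᵥ w) k = 0) (hwr : ∀ i ∈ J, w i + r i = signVec (U *ᵥ x) i)
    (hw' : ∀ i, i ∉ J → ‖w i‖ ≤ 1 / 2) (hr : √(nsq r) ≤ ε)
    (hW : ∀ i ∈ J, ∀ k, k ∉ S → (Uᴴ *ᵥ W i) k = 0)
    (hWR : ∀ i ∈ J, ∀ j ∈ J, W i j + R i j = Pi.single (M := fun _ => ℂ) i 1 j)
    (hW' : ∀ i ∈ J, ∀ j, j ∉ J → ‖W i j‖ ≤ Γ) (hR : ∀ i ∈ J, √(nsq (R i)) ≤ η)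
    (hη : J.card * η ≤ 1 / 2) (hε0 : 0 ≤ ε) (hε : ε * (2 * J.card * Γ) ≤ 1 / 4) :
    IsStrictMinimizer U x S := by
  intro h hh hne
  set y := U *ᵥ h with hy
  set z := U *ᵥ x with hz
  set ρ := √(∑ i ∈ J, ‖y i‖ ^ 2) with hρ
  set τ := ∑ i ∈ Jᶜ, ‖y i‖ with hτ
  have hρ0 : 0 ≤ ρ := Real.sqrt_nonneg _
  have hτ0 : 0 ≤ τ := Finset.sum_nonneg fun _ _ => norm_nonneg _
  have h1 : ∀ i ∈ J, ‖y i‖ ≤ η * ρ + Γ * τ := by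
    intro i hi
    have h2 := norm_sum_star_mul_le (star_dotProduct_mulVec_eq_zero (hW i hi) hh) (hWR i hi)
      (hW' i hi)
    rw [Finset.sum_eq_single i (by intro j _ hj; simp [Pi.single_eq_of_ne hj])
      (fun h => absurd hi h)] at h2
    simp only [Pi.single_eq_same, star_one, one_mul] at h2
    refine h2.trans ?_
    gcongr
    exact hR i hi
  -- Summing `h1` over `J` gives `ρ ≤ J.card * (η ρ + Γ τ)`, and `J.card * η ≤ 1/2` absorbs the term
  -- in `ρ`.
  have h2 : ρ ≤ 2 * J.card * Γ * τ := by
    have h3 : ρ ≤ ∑ i ∈ J, ‖y i‖ := by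
      refine Real.sqrt_le_iff.2 ⟨Finset.sum_nonneg fun _ _ => norm_nonneg _, ?_⟩
      exact Finset.sum_sq_le_sq_sum_of_nonneg fun _ _ => norm_nonneg _
    have h4 := h3.trans (Finset.sum_le_card_nsmul _ _ _ h1)
    rw [nsmul_eq_mul] at h4
    nlinarith
  have h3 : -(τ * (3 / 4)) ≤ (∑ i ∈ J, star (signVec z i) * y i).re := by
    have h4 := norm_sum_star_mul_le (star_dotProduct_mulVec_eq_zero hw hh) hwr hw'
    have h5 : √(nsq r) * ρ ≤ τ / 4 := by
      calc √(nsq r) * ρ ≤ ε * (2 * J.card * Γ * τ) := by gcongr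
        _ = ε * (2 * J.card * Γ) * τ := by ring
        _ ≤ 1 / 4 * τ := by gcongr
        _ = τ / 4 := by ring
    have h6 := (abs_le.1 (Complex.abs_re_le_norm (∑ i ∈ J, star (signVec z i) * y i))).1
    linarith
  have h4 : ∀ i ∈ J, ‖z i‖ + (star (signVec z i) * y i).re ≤ ‖z i + y i‖ := by
    intro i hi
    have hzi : (‖z i‖ : ℂ) ≠ 0 := by simpa using (hJ i).1 hi
    have h5 : ‖star (signVec z i)‖ = 1 := by
      simp only [signVec, norm_star, norm_div, Complex.norm_real, norm_norm]
      exact div_self (by exact_mod_cast hzi)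
    have h6 : star (signVec z i) * z i = ‖z i‖ := by
      simp only [signVec, star_div₀, Complex.star_def, Complex.conj_ofReal]
      rw [div_mul_eq_mul_div, Complex.conj_mul', div_eq_iff hzi, sq]
    have h7 := Complex.re_le_norm (star (signVec z i) * (z i + y i))
    rw [norm_mul, h5, one_mul, mul_add, h6] at h7
    simpa using h7
  have h5 : l1Norm z + (∑ i ∈ J, star (signVec z i) * y i).re + τ ≤ l1Norm (U *ᵥ (x + h)) := by
    rw [Matrix.mulVec_add, ← hy, ← hz, l1Norm, l1Norm, ← Finset.sum_add_sum_compl J,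
      ← Finset.sum_add_sum_compl J fun i => ‖(z + y) i‖]
    have hz0 : ∀ i ∈ Jᶜ, z i = 0 := by
      intro i hi
      by_contra hcon
      exact Finset.mem_compl.1 hi ((hJ i).2 hcon)
    have e1 : ∑ i ∈ Jᶜ, ‖z i‖ = 0 := Finset.sum_eq_zero fun i hi => by simp [hz0 i hi]
    have e2 : ∑ i ∈ Jᶜ, ‖(z + y) i‖ = τ :=
      Finset.sum_congr rfl fun i hi => by simp [hz0 i hi]
    have e3 := Finset.sum_le_sum h4
    rw [Finset.sum_add_distrib, ← Complex.re_sum] at e3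
    rw [e1, e2]
    simp only [Pi.add_apply]
    linarith
  -- If `τ = 0`, then `ρ = 0` as well, so `Uh = 0`, contradicting injectivity and `h ≠ 0`.
  rcases hτ0.eq_or_lt with h0 | h0
  · exfalso
    rw [← h0, mul_zero] at h2
    have hρ' : ∑ i ∈ J, ‖y i‖ ^ 2 = 0 :=
      (Real.sqrt_eq_zero (Finset.sum_nonneg fun _ _ => by positivity)).1 (le_antisymm h2 hρ0)
    have hy0 : y = 0 := by
      ext i
      by_cases hi : i ∈ J
      · simpa using (Finset.sum_eq_zero_iff_of_nonneg fun _ _ => by positivity).1 hρ' i hi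
      · simpa using (Finset.sum_eq_zero_iff_of_nonneg fun _ _ => norm_nonneg _).1 h0.symm i
          (Finset.mem_compl.2 hi)
    exact hne (hU (by simpa [hy] using hy0))
  · linarith

end Recovery

/-! ### Batch sizes and the decay of the residual envelope -/

section Schedule

/-- The relative size of a batch: the first two batches are larger than the others. -/
noncomputable def batchWeight (lam : ℝ) (l : ℕ) : ℝ := if l < 2 then lam else 1

/-- The envelope for the squared norms of the residuals. -/
noncomputable def envelope (lam : ℝ) (l : ℕ) : ℝ := 16 * (256 ^ l * lam ^ min l 2)⁻¹

theorem one_le_batchWeight {lam : ℝ} (hlam : 1 ≤ lam) (l : ℕ) : 1 ≤ batchWeight lam l := by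
  rw [batchWeight]
  split_ifs <;> linarith

theorem envelope_pos {lam : ℝ} (hlam : 1 ≤ lam) (l : ℕ) : 0 < envelope lam l := by
  rw [envelope]
  positivity

theorem prod_batchWeight_inv (lam : ℝ) (l : ℕ) :
    ∏ r ∈ Finset.range l, (512 * batchWeight lam r)⁻¹ = (512 ^ l * lam ^ min l 2)⁻¹ := by
  rw [Finset.prod_inv_distrib, Finset.prod_mul_distrib, Finset.prod_const, Finset.card_range]
  congr 2
  induction l with
  | zero => simp
  | succ l ih =>
    rw [Finset.prod_range_succ, ih, batchWeight]
    split_ifs with h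
    · rw [min_eq_left (by omega), min_eq_left (by omega), pow_succ]
    · rw [min_eq_right (by omega), min_eq_right (by omega), mul_one]

theorem envelope_le {lam : ℝ} (hlam : 1 ≤ lam) (l : ℕ) :
    envelope lam l ≤ (4 * (1 / 16) ^ l) ^ 2 := by
  have h1 : (1 : ℝ) ≤ lam ^ min l 2 := one_le_pow₀ hlam
  have h2 : (4 * (1 / 16 : ℝ) ^ l) ^ 2 = 16 * (256 ^ l)⁻¹ := by
    rw [mul_pow, ← pow_mul, mul_comm l 2, pow_mul, ← inv_pow]
    norm_num
  rw [h2, envelope]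
  gcongr
  exact le_mul_of_one_le_right (by positivity) h1

/-- This serves the step-size condition of the exponential moment bound. Batches of relative size
`1` need an envelope of order `lam⁻²`. Each of the two large batches supplies one factor `lam⁻¹`,
hence exactly two of them. -/
theorem sq_mul_envelope_le {lam : ℝ} (hlam : 1 ≤ lam) (l : ℕ) :
    lam ^ 2 * envelope lam l ≤ 16 * (1 / 256) ^ l * batchWeight lam l ^ 2 := by
  have h0 : 0 < lam := by linarith
  rw [envelope, batchWeight, one_div, inv_pow, mul_inv]
  split_ifs with h
  · have h1 : (lam ^ min l 2)⁻¹ ≤ 1 := inv_le_one_of_one_le₀ (one_le_pow₀ hlam)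
    calc lam ^ 2 * (16 * ((256 ^ l)⁻¹ * (lam ^ min l 2)⁻¹))
        ≤ lam ^ 2 * (16 * ((256 ^ l)⁻¹ * 1)) := by gcongr
      _ = _ := by ring
  · rw [min_eq_right (by omega)]
    apply le_of_eq
    field_simp

/-- This makes the exponents contributed by the batches sum to a small multiple of `lam`. -/
theorem mul_envelope_le {lam : ℝ} (hlam : 1 ≤ lam) (l : ℕ) :
    lam * envelope lam l ≤ 16 * (1 / 256) ^ l * batchWeight lam l := by
  have h0 : 0 < lam := by linarith
  rw [envelope, batchWeight, one_div, inv_pow, mul_inv]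
  split_ifs with h
  · have h1 : (lam ^ min l 2)⁻¹ ≤ 1 := inv_le_one_of_one_le₀ (one_le_pow₀ hlam)
    calc lam * (16 * ((256 ^ l)⁻¹ * (lam ^ min l 2)⁻¹))
        ≤ lam * (16 * ((256 ^ l)⁻¹ * 1)) := by gcongr
      _ = _ := by ring
  · rw [min_eq_right (by omega)]
    have h1 : lam * (lam ^ 2)⁻¹ ≤ 1 := by
      rw [← div_eq_mul_inv, div_le_one (by positivity)]
      nlinarith
    calc lam * (16 * ((256 ^ l)⁻¹ * (lam ^ 2)⁻¹))
        = 16 * (256 ^ l)⁻¹ * (lam * (lam ^ 2)⁻¹) := by ring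
      _ ≤ _ := by gcongr

theorem sum_geometric_le {x : ℝ} (h0 : 0 ≤ x) (h1 : x < 1) (L : ℕ) :
    ∑ r ∈ Finset.range L, x ^ r ≤ 1 / (1 - x) := by
  rw [one_div, ← tsum_geometric_of_lt_one h0 h1]
  exact (summable_geometric_of_lt_one h0 h1).sum_le_tsum _ fun _ _ => by positivity

/-- The sizes of the batches. -/
noncomputable def batchSize (sg lam : ℝ) (l : ℕ) : ℕ :=
  ⌈512 * sg⌉₊ + if l < 2 then ⌈512 * sg * lam⌉₊ else 0

theorem le_batchSize (sg lam : ℝ) (l : ℕ) :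
    512 * sg * batchWeight lam l ≤ batchSize sg lam l := by
  rw [batchSize, batchWeight]
  push_cast
  split_ifs with h
  · have := Nat.le_ceil (512 * sg * lam)
    have h2 : (0 : ℝ) ≤ ⌈512 * sg⌉₊ := by positivity
    linarith
  · have := Nat.le_ceil (512 * sg)
    simpa using this

theorem sum_batchSize_le {sg lam : ℝ} (hsg : 1 ≤ sg) (hlam : 1 ≤ lam) (L : ℕ) :
    (∑ r ∈ Finset.range L, batchSize sg lam r : ℝ) ≤ 1024 * sg * (2 * lam + L) := by
  have h1 : (⌈512 * sg⌉₊ : ℝ) ≤ 1024 * sg := by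
    have := Nat.ceil_lt_add_one (a := 512 * sg) (by positivity)
    linarith
  have h2 : (⌈512 * sg * lam⌉₊ : ℝ) ≤ 1024 * sg * lam := by
    have := Nat.ceil_lt_add_one (a := 512 * sg * lam) (by positivity)
    nlinarith
  have h3 : ∑ r ∈ Finset.range L, (if r < 2 then (⌈512 * sg * lam⌉₊ : ℝ) else 0)
      ≤ 2 * ⌈512 * sg * lam⌉₊ := by
    rw [← Finset.sum_filter, Finset.sum_const, nsmul_eq_mul]
    gcongr
    have : (Finset.range L).filter (· < 2) ⊆ Finset.range 2 := fun r hr => by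
      simpa using (Finset.mem_filter.1 hr).2
    exact_mod_cast (Finset.card_le_card this).trans_eq (Finset.card_range 2)
  simp only [batchSize]
  push_cast
  rw [Finset.sum_add_distrib, Finset.sum_const, Finset.card_range, nsmul_eq_mul]
  have h4 : (L : ℝ) * ⌈512 * sg⌉₊ ≤ L * (1024 * sg) := by gcongr
  linarith

end Schedule

/-! ### One group of batches succeeds with probability at least one half -/

section Group

variable {n N : ℕ} {U V : Matrix (Fin N) (Fin n) ℂ} {μ M : ℝ} {J : Finset (Fin N)}

theorem nsq_signVec_le {z : Fin N → ℂ} (hJ : ∀ i, i ∈ J ↔ z i ≠ 0) :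
    nsq (signVec z) ≤ J.card := by
  rw [nsq, ← Finset.sum_subset (Finset.subset_univ J)]
  · refine (Finset.sum_le_card_nsmul J _ 1 fun i _ => ?_).trans_eq (by simp)
    have : ‖signVec z i‖ ≤ 1 := by
      simp only [signVec, norm_div, Complex.norm_real, norm_norm]
      exact div_self_le_one _
    exact pow_le_one₀ (norm_nonneg _) this
  · intro i _ hi
    have : z i = 0 := by
      by_contra hcon
      exact hi ((hJ i).2 hcon)
    simp [signVec, this]

theorem nsq_single (i : Fin N) : nsq (Pi.single i 1 : Fin N → ℂ) = 1 := by
  rw [nsq, Finset.sum_eq_single i (by intro j _ hj; simp [Pi.single_eq_of_ne hj]) (by simp)]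
  simp

variable (U V J) in
/-- The total squared size of the residuals that start from `q` and from the basis vectors. -/
noncomputable def totalResidual {m : ℕ → ℕ} (q : Fin N → ℂ) (l : ℕ)
    (p : SampleIdx m l → Fin n) : ℝ :=
  nsq (residual U V J q l p) + ∑ i ∈ J, nsq (residual U V J (Pi.single i 1) l p)

theorem expect_totalResidual_le [NeZero n] (h : IsIncoherentPair U V μ M) (hμ : 0 ≤ μ)
    {m : ℕ → ℕ} (hm : ∀ l, 0 < m l) {q : Fin N → ℂ} (hq : nsq q ≤ J.card) (l : ℕ) :
    𝔼 p : SampleIdx m l → Fin n, totalResidual U V J q l p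
      ≤ (∏ r ∈ Finset.range l, 2 * μ * J.card / m r) * (2 * J.card) := by
  simp only [totalResidual]
  rw [Finset.expect_add_distrib, Finset.expect_sum_comm]
  have h0 : 0 ≤ ∏ r ∈ Finset.range l, 2 * μ * J.card / m r :=
    Finset.prod_nonneg fun _ _ => by positivity
  have h1 := (expect_nsq_residual_le (J := J) h hμ hm q l).trans
    (mul_le_mul_of_nonneg_left hq h0)
  have h3 := Finset.sum_le_sum fun i (_ : i ∈ J) =>
    (expect_nsq_residual_le (J := J) h hμ hm (Pi.single i 1) l)
  simp only [nsq_single, Finset.sum_const, nsmul_eq_mul] at h3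
  linarith

/-- The mean decays like `512^{-l}` and the envelope only like `256^{-l}`, with the same powers of
`lam`. Markov's inequality therefore leaves `2^{-l}`, which is summable over the batches. -/
theorem frac_envelope_lt_totalResidual_le [NeZero n] (h : IsIncoherentPair U V μ M)
    (hμ : 0 < μ) (hJ : J.Nonempty) {lam : ℝ} (hlam : 1 ≤ lam) {q : Fin N → ℂ}
    (hq : nsq q ≤ J.card) (l : ℕ) :
    frac (fun p : SampleIdx (batchSize (2 * μ * J.card) lam) l → Fin n =>
      ¬ totalResidual U V J q l p ≤ J.card * envelope lam l) ≤ 1 / 8 * (1 / 2) ^ l := by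
  have hc : (0 : ℝ) < J.card := by exact_mod_cast hJ.card_pos
  have ha := envelope_pos hlam l
  have hm : ∀ r, 512 * (2 * μ * J.card) * batchWeight lam r
      ≤ batchSize (2 * μ * J.card) lam r := le_batchSize _ lam
  have hm0 : ∀ r, (0 : ℝ) < batchSize (2 * μ * J.card) lam r := fun r => by
    have := one_le_batchWeight hlam r
    exact lt_of_lt_of_le (by positivity) (hm r)
  have h1 := expect_totalResidual_le h hμ.le (fun r => by exact_mod_cast hm0 r) hq l
  have h2 : ∏ r ∈ Finset.range l, 2 * μ * J.card / batchSize (2 * μ * J.card) lam r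
      ≤ (512 ^ l * lam ^ min l 2)⁻¹ := by
    rw [← prod_batchWeight_inv]
    refine Finset.prod_le_prod (fun r _ => by positivity) fun r _ => ?_
    have hw : 0 < batchWeight lam r := lt_of_lt_of_le one_pos (one_le_batchWeight hlam r)
    rw [div_le_iff₀ (hm0 r), inv_mul_eq_div, le_div_iff₀ (by positivity)]
    linarith [hm r]
  refine (frac_le_of_le (t := J.card * envelope lam l) (by positivity)
    (f := totalResidual U V J q l)
    (fun p => add_nonneg (nsq_nonneg _) (Finset.sum_nonneg fun _ _ => nsq_nonneg _))
    fun p hp => (not_le.1 hp).le).trans ?_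
  rw [div_le_iff₀ (by positivity)]
  refine h1.trans ((mul_le_mul_of_nonneg_right h2 (by positivity)).trans_eq ?_)
  have h0 : 0 < lam := by linarith
  have h3 : (512 : ℝ) ^ l = 2 ^ l * 256 ^ l := by rw [← mul_pow]; norm_num
  rw [envelope, h3, one_div_pow]
  field_simp
  norm_num

/-- `Always` at stage `L` controls only the residuals before `L`, which bound the basis
certificates. The final residual, which gives `ε` and `η`, needs the separate hypothesis `h2`. -/
theorem isStrictMinimizer_of_events [NeZero n] (h : IsIncoherentPair U V μ M) (hM : 1 ≤ M)
    (hN : 1 ≤ N) (hnN : n ≤ N) {x : Fin n → ℂ} (hJ : ∀ i, i ∈ J ↔ (U *ᵥ x) i ≠ 0) {lam : ℝ}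
    (hlam : 1 ≤ lam) {m : ℕ → ℕ} {L : ℕ} (hL : 3 + 3 * Real.log N + Real.log M ≤ L)
    {p : SampleIdx m L → Fin n}
    (h1 : Always (fun l p => totalResidual U V J (signVec (U *ᵥ x)) l p
      ≤ J.card * envelope lam l) L p)
    (h2 : totalResidual U V J (signVec (U *ᵥ x)) L p ≤ J.card * envelope lam L)
    (h3 : ∀ i, i ∉ J → ‖certificate U V J (signVec (U *ᵥ x)) L p i‖ ≤ 1 / 2) :
    IsStrictMinimizer U x (Set.range p) := by
  set q := signVec (U *ᵥ x) with hq
  set c : ℝ := (J.card : ℝ) with hc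
  have hc0 : 0 ≤ c := by positivity
  have hcN : c ≤ N := by
    have := Finset.card_le_univ J
    rw [Fintype.card_fin] at this
    rw [hc]
    exact_mod_cast this
  have hN' : (1 : ℝ) ≤ N := by exact_mod_cast hN
  -- The product `ε * (2 * J.card * Γ)` is at most `120 N³ M / 16^L`, which `16^L` must bring below
  -- `1/4`.
  have hpow : 16 ^ 3 * (N : ℝ) ^ 3 * M ≤ 16 ^ L := by
    have e1 : (1 : ℝ) ≤ Real.log 16 := by
      rw [Real.le_log_iff_exp_le (by norm_num)]
      linarith [Real.exp_one_lt_d9]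
    have e2 : 0 ≤ Real.log N := Real.log_nonneg hN'
    have e3 : 0 ≤ Real.log M := Real.log_nonneg hM
    rw [← Real.log_le_log_iff (by positivity) (by positivity), Real.log_mul (by positivity)
      (by positivity), Real.log_mul (by positivity) (by positivity), Real.log_pow, Real.log_pow,
      Real.log_pow]
    push_cast
    nlinarith
  have hsqrt : ∀ l, √(c * envelope lam l) ≤ √c * (4 * (1 / 16) ^ l) := by
    intro l
    rw [Real.sqrt_mul hc0]
    gcongr
    exact Real.sqrt_le_iff.2 ⟨by positivity, envelope_le hlam l⟩
  have hres1 : ∀ l (p : SampleIdx m l → Fin n), totalResidual U V J q l p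
      ≤ c * envelope lam l → √(nsq (residual U V J q l p)) ≤ √c * (4 * (1 / 16) ^ l) := by
    intro l p hp
    refine (Real.sqrt_le_sqrt (le_trans ?_ hp)).trans (hsqrt l)
    exact le_add_of_nonneg_right (Finset.sum_nonneg fun _ _ => nsq_nonneg _)
  have hres2 : ∀ i ∈ J, ∀ l (p : SampleIdx m l → Fin n), totalResidual U V J q l p
      ≤ c * envelope lam l →
      √(nsq (residual U V J (Pi.single i 1) l p)) ≤ √c * (4 * (1 / 16) ^ l) := by
    intro i hi l p hp
    refine (Real.sqrt_le_sqrt (le_trans ?_ hp)).trans (hsqrt l)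
    refine (Finset.single_le_sum (f := fun i => nsq (residual U V J (Pi.single i 1) l p))
      (fun _ _ => nsq_nonneg _) hi).trans ?_
    exact le_add_of_nonneg_left (nsq_nonneg _)
  have hΓ : ∀ i ∈ J, ∀ j, ‖certificate U V J (Pi.single i 1) L p j‖ ≤ 15 * N * M * √c := by
    intro i hi j
    refine (norm_certificate_le h (by linarith) (hres2 i hi) p h1 j).trans ?_
    rw [← Finset.mul_sum, ← Finset.mul_sum]
    have e1 := sum_geometric_le (x := (1 / 16 : ℝ)) (by norm_num) (by norm_num) L
    have e2 : 1 + 2 * n * M ≤ 3 * N * M := by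
      have : (n : ℝ) ≤ N := by exact_mod_cast hnN
      have e3 : (n : ℝ) * M ≤ N * M := by gcongr
      nlinarith
    calc (1 + 2 * n * M) * (√c * (4 * ∑ r ∈ Finset.range L, (1 / 16 : ℝ) ^ r))
        ≤ (3 * N * M) * (√c * (4 * (1 / (1 - 1 / 16)))) := by gcongr
      _ = (64 / 5) * N * M * √c := by ring
      _ ≤ _ := by gcongr; norm_num
  have hsN : √c ≤ N := (Real.sqrt_le_iff.2 ⟨by positivity, by nlinarith⟩)
  have hL0 : (0 : ℝ) < 16 ^ L := by positivity
  have hinj : Function.Injective fun g : Fin n → ℂ => U *ᵥ g := by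
    intro g g' hg
    have := congrArg (fun v => Vᴴ *ᵥ v) hg
    simpa [Matrix.mulVec_mulVec, h.dual] using this
  refine isStrictMinimizer_of_certificates hinj hJ
    (w := certificate U V J q L p) (r := residual U V J q L p)
    (W := fun i => certificate U V J (Pi.single i 1) L p)
    (R := fun i => residual U V J (Pi.single i 1) L p)
    (ε := √c * (4 * (1 / 16) ^ L)) (η := √c * (4 * (1 / 16) ^ L)) (Γ := 15 * N * M * √c)
    (fun k hk => adjoint_mulVec_certificate h q p hk)
    (fun i hi => certificate_add_residual q p hi) h3 (hres1 L p h2)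
    (fun i hi k hk => adjoint_mulVec_certificate h _ p hk)
    (fun i hi j hj => certificate_add_residual _ p hj) (fun i hi j _ => hΓ i hi j)
    (fun i hi => hres2 i hi L p h2) ?_ (by positivity) ?_
  · rw [one_div_pow, ← hc]
    have e1 : c * √c ≤ N * N := by gcongr
    have e2 : (N : ℝ) * N ≤ N ^ 3 * M := by
      calc (N : ℝ) * N = N ^ 2 * 1 := by ring
        _ ≤ N ^ 3 * M := by gcongr; norm_num
    calc c * (√c * (4 * (1 / 16 ^ L))) = 4 * (c * √c) / 16 ^ L := by ring
      _ ≤ 1 / 2 := by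
        rw [div_le_iff₀ hL0]
        nlinarith
  · rw [one_div_pow, ← hc]
    calc √c * (4 * (1 / 16 ^ L)) * (2 * c * (15 * N * M * √c))
        = 120 * (√c * √c) * c * N * M / 16 ^ L := by ring
      _ = 120 * (c * c * N * M) / 16 ^ L := by rw [Real.mul_self_sqrt hc0]; ring
      _ ≤ 120 * (N * N * N * M) / 16 ^ L := by gcongr
      _ ≤ 1 / 4 := by
        rw [div_le_iff₀ hL0]
        nlinarith

/-- A group of `O(μ s (log N + log M))` samples recovers with probability at least one half. -/
theorem exists_frac_not_isStrictMinimizer_le [NeZero n] (h : IsIncoherentPair U V μ M)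
    (hM : 1 ≤ M) (hN : 2 ≤ N) (hnN : n ≤ N) {x : Fin n → ℂ}
    (hJ : ∀ i, i ∈ J ↔ (U *ᵥ x) i ≠ 0) (hJ0 : J.Nonempty) (hμJ : 1 ≤ μ * J.card) :
    ∃ (m : ℕ → ℕ) (L : ℕ),
      (Fintype.card (SampleIdx m L) : ℝ)
        ≤ 200000 * (μ * J.card) * (Real.log N + Real.log M) ∧
      frac (fun p : SampleIdx m L → Fin n => ¬ IsStrictMinimizer U x (Set.range p)) ≤ 1 / 2 := by
  have hc : (0 : ℝ) < J.card := by exact_mod_cast hJ0.card_pos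
  have hμ : 0 < μ := by
    by_contra hcon
    nlinarith
  have hN' : (2 : ℝ) ≤ N := by exact_mod_cast hN
  have hlogN : 0.6931471803 < Real.log N :=
    Real.log_two_gt_d9.trans_le (Real.log_le_log (by norm_num) hN')
  have hlogM : 0 ≤ Real.log M := Real.log_nonneg hM
  -- With this choice `e^{-lam/8} = N^{-5}`, so the union bound over `N` coordinates and four
  -- directions costs `4 N^{-4} ≤ 1/4`.
  set lam := 40 * Real.log N with hlamdef
  have hlam : 1 ≤ lam := by linarith
  set sg := 2 * μ * J.card with hsg
  have hsg1 : 1 ≤ sg := by nlinarith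
  set m := batchSize sg lam with hmdef
  set L := ⌈3 + 3 * Real.log N + Real.log M⌉₊ with hLdef
  have hL : 3 + 3 * Real.log N + Real.log M ≤ L := Nat.le_ceil _
  have hL' : L < 3 + 3 * Real.log N + Real.log M + 1 := Nat.ceil_lt_add_one (by positivity)
  set q := signVec (U *ᵥ x) with hq
  have hm : ∀ r, 512 * sg * batchWeight lam r ≤ m r := le_batchSize _ lam
  have hw : ∀ r, 1 ≤ batchWeight lam r := one_le_batchWeight hlam
  have hm0 : ∀ r, (0 : ℝ) < m r := fun r => by
    have := hw r
    exact lt_of_lt_of_le (by positivity) (hm r)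
  refine ⟨m, L, ?_, ?_⟩
  · rw [SampleIdx.card]
    push_cast
    refine (sum_batchSize_le hsg1 hlam L).trans ?_
    calc 1024 * sg * (2 * lam + L) ≤ 1024 * sg * (90 * (Real.log N + Real.log M)) := by
          gcongr
          linarith
      _ = 184320 * (μ * J.card) * (Real.log N + Real.log M) := by rw [hsg]; ring
      _ ≤ _ := by
          have : 0 ≤ Real.log N + Real.log M := by linarith
          gcongr
          norm_num
  · set Q : ∀ l, (SampleIdx m l → Fin n) → Prop :=
      fun l p => totalResidual U V J q l p ≤ J.card * envelope lam l with hQ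
    have hQres : ∀ l p, Q l p → nsq (residual U V J q l p) ≤ J.card * envelope lam l :=
      fun l p hp => le_trans
        (le_add_of_nonneg_right (Finset.sum_nonneg fun _ _ => nsq_nonneg _)) hp
    have hqs : ∀ i, i ∉ J → q i = 0 := by
      intro i hi
      have : (U *ᵥ x) i = 0 := by
        by_contra hcon
        exact hi ((hJ i).2 hcon)
      simp [hq, signVec, this]
    have hQf : ∀ l, frac (fun p => ¬ Q l p) ≤ 1 / 8 * (1 / 2) ^ l := fun l =>
      frac_envelope_lt_totalResidual_le h hμ hJ0 hlam (nsq_signVec_le hJ) l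
    have hstep : ∀ l, (lam * (2 * μ * J.card)) ^ 2 * envelope lam l ≤ m l ^ 2 := by
      intro l
      have e1 := sq_mul_envelope_le hlam l
      have e2 : (1 / 256 : ℝ) ^ l ≤ 1 := pow_le_one₀ (by norm_num) (by norm_num)
      calc (lam * sg) ^ 2 * envelope lam l = sg ^ 2 * (lam ^ 2 * envelope lam l) := by ring
        _ ≤ sg ^ 2 * (16 * (1 / 256) ^ l * batchWeight lam l ^ 2) := by gcongr
        _ ≤ sg ^ 2 * (16 * 1 * batchWeight lam l ^ 2) := by gcongr
        _ ≤ (512 * sg * batchWeight lam l) ^ 2 := by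
            have : 0 ≤ (sg * batchWeight lam l) ^ 2 := sq_nonneg _
            nlinarith
        _ ≤ _ := by
            have := hw l
            gcongr
            exact hm l
    have hsum : ∑ r ∈ Finset.range L, lam ^ 2 * (2 * μ * J.card) * envelope lam r / m r
        ≤ lam / 8 := by
      have e1 : ∀ r ∈ Finset.range L, lam ^ 2 * (2 * μ * J.card) * envelope lam r / m r
          ≤ lam / 32 * (1 / 256) ^ r := by
        intro r _
        have e2 := mul_envelope_le hlam r
        rw [div_le_iff₀ (hm0 r)]
        calc lam ^ 2 * sg * envelope lam r = lam * sg * (lam * envelope lam r) := by ring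
          _ ≤ lam * sg * (16 * (1 / 256) ^ r * batchWeight lam r) := by gcongr
          _ = lam / 32 * (1 / 256) ^ r * (512 * sg * batchWeight lam r) := by ring
          _ ≤ _ := by gcongr; exact hm r
      refine (Finset.sum_le_sum e1).trans ?_
      rw [← Finset.mul_sum]
      have e3 := sum_geometric_le (x := (1 / 256 : ℝ)) (by norm_num) (by norm_num) L
      norm_num at e3 ⊢
      nlinarith
    have hoff : ∀ i, frac (fun p : SampleIdx m L → Fin n =>
        i ∉ J ∧ Always Q L p ∧ 1 / 2 < ‖certificate U V J q L p i‖)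
        ≤ 4 * Real.exp (-(lam / 8)) := by
      intro i
      by_cases hi : i ∈ J
      · refine le_trans (b := 0) (le_of_eq ?_) (by positivity)
        simp [frac, hi]
      · refine (frac_mono fun p hp => hp.2).trans ?_
        exact frac_lt_norm_certificate_le h (fun r => by exact_mod_cast hm0 r) hqs hQres
          (by linarith) hstep hi L hsum
    have hexp : N * (4 * Real.exp (-(lam / 8))) ≤ 1 / 4 := by
      have e1 : Real.exp (-(lam / 8)) = ((N : ℝ) ^ 5)⁻¹ := by
        rw [Real.exp_neg, hlamdef, show 40 * Real.log N / 8 = Real.log ((N : ℝ) ^ 5) by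
          rw [Real.log_pow]; push_cast; ring, Real.exp_log (by positivity)]
      have e2 : (2 : ℝ) ^ 4 ≤ (N : ℝ) ^ 4 := by gcongr
      rw [e1, ← div_eq_mul_inv, mul_div_assoc', div_le_iff₀ (by positivity)]
      nlinarith
    -- The sum runs over `L + 1` residual events, because the final residual is included. Their
    -- total probability is at most `1/4`.
    have hgeo := sum_geometric_le (x := (1 / 2 : ℝ)) (by norm_num) (by norm_num) (L + 1)
    calc frac (fun p : SampleIdx m L → Fin n => ¬ IsStrictMinimizer U x (Set.range p))
        ≤ frac (fun p : SampleIdx m L → Fin n => (¬ Always Q L p ∨ ¬ Q L p) ∨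
          ∃ i, i ∉ J ∧ Always Q L p ∧ 1 / 2 < ‖certificate U V J q L p i‖) := by
          refine frac_mono fun p hp => ?_
          by_contra hcon
          push Not at hcon
          exact hp (isStrictMinimizer_of_events h hM (by omega) hnN hJ hlam hL hcon.1.1 hcon.1.2
            fun i hi => hcon.2 i hi hcon.1.1)
      _ ≤ (∑ r ∈ Finset.range L, frac (fun p => ¬ Q r p) + frac (fun p => ¬ Q L p))
          + ∑ i : Fin N, 4 * Real.exp (-(lam / 8)) := by
          refine (frac_or_le _ _).trans (add_le_add ((frac_or_le _ _).trans
            (add_le_add (frac_not_always_le Q L) le_rfl)) ?_)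
          exact (frac_exists_le _).trans (Finset.sum_le_sum fun i _ => hoff i)
      _ ≤ 1 / 4 + 1 / 4 := by
          refine add_le_add ?_ (by simpa using hexp)
          rw [← Finset.sum_range_succ fun r => frac fun p => ¬ Q r p]
          refine (Finset.sum_le_sum fun r _ => hQf r).trans ?_
          rw [← Finset.mul_sum]
          norm_num at hgeo ⊢
          linarith
      _ = 1 / 2 := by norm_num

end Group

/-! ### From averages to probabilities, and amplification by independent groups -/

section Sampling

theorem frac_forall_fin {α : Type*} [Fintype α] (p : α → Prop) (K : ℕ) :
    frac (fun b : Fin K → α => ∀ j, p (b j)) = frac p ^ K := by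
  classical
  induction K with
  | zero => simp [frac]
  | succ K ih =>
    rw [pow_succ', ← ih, frac, expect_fin_succ, frac, Finset.expect_mul]
    refine Finset.expect_congr rfl fun a _ => ?_
    by_cases ha : p a
    · simp only [Fin.forall_fin_succ, Fin.cons_zero, Fin.cons_succ, ha, true_and, if_true,
        one_mul, frac]
      congr!
    · simp [Fin.forall_fin_succ, ha]

theorem frac_forall_prod {ι α : Type*} [Fintype ι] [DecidableEq ι] [Fintype α]
    (p : (ι → α) → Prop) (K : ℕ) :
    frac (fun b : Fin K × ι → α => ∀ g, p fun j => b (g, j)) = frac p ^ K := by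
  classical
  rw [← frac_forall_fin]
  exact Fintype.expect_equiv (Equiv.curry (Fin K) ι α) _ _ fun b => rfl

theorem measureReal_eq_frac {n : ℕ} [NeZero n] {ι : Type*} [Fintype ι] [DecidableEq ι]
    {Ω : Type*} [MeasurableSpace Ω] (P : Measure Ω) [IsProbabilityMeasure P] {ω : ι → Ω → Fin n}
    (hlaw : ∀ j, HasLaw (ω j) (uniformOn (Set.univ : Set (Fin n))) P) (hind : iIndepFun ω P)
    (p : (ι → Fin n) → Prop) : P.real {w | p fun j => ω j w} = frac p := by
  classical
  have h1 : P.map (fun w j => ω j w) = uniformOn (Set.univ : Set (ι → Fin n)) := by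
    rw [(iIndepFun_iff_map_fun_eq_pi_map fun j => (hlaw j).aemeasurable).1 hind,
      ← Set.pi_univ Set.univ, uniformOn_pi]
    simp only [(hlaw _).map_eq]
  have h2 : P {w | p fun j => ω j w} = uniformOn (Set.univ : Set (ι → Fin n)) {b | p b} := by
    rw [← h1, Measure.map_apply_of_aemeasurable
      (aemeasurable_pi_lambda _ fun j => (hlaw j).aemeasurable) (Set.toFinite _).measurableSet]
    rfl
  have h3 : {b : ι → Fin n | p b} = ((Finset.univ.filter p : Finset (ι → Fin n)) : Set _) := by
    simp
  rw [Measure.real, h2, h3, ← Finset.coe_univ, uniformOn_apply_finset, frac,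
    Fintype.expect_eq_sum_div_card]
  simp

/-- Two groups per unit of `β` suffice because `(1/2)² ≤ e^{-1}`. -/
theorem frac_forall_le_exp {ι α : Type*} [Fintype ι] [DecidableEq ι] [Fintype α]
    {p : (ι → α) → Prop} (hp : frac p ≤ 1 / 2) (β : ℝ) :
    frac (fun b : Fin (2 * ⌈β⌉₊) × ι → α => ∀ g, p fun j => b (g, j)) ≤ Real.exp (-β) := by
  have h0 : 0 ≤ frac p := expect_nonneg' fun _ => by positivity
  rw [frac_forall_prod, pow_mul]
  have h1 : frac p ^ 2 ≤ Real.exp (-1) := by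
    have h2 : frac p ^ 2 ≤ (1 / 2) ^ 2 := by gcongr
    have h3 : (1 : ℝ) / 4 ≤ Real.exp (-1) := by
      rw [Real.exp_neg, one_div]
      exact inv_anti₀ (Real.exp_pos _) (by linarith [Real.exp_one_lt_d9])
    linarith
  calc (frac p ^ 2) ^ ⌈β⌉₊ ≤ Real.exp (-1) ^ ⌈β⌉₊ := by gcongr
    _ = Real.exp (-⌈β⌉₊) := by rw [← Real.exp_nat_mul]; simp
    _ ≤ _ := Real.exp_le_exp.2 (neg_le_neg (Nat.le_ceil β))

end Sampling

/-! ### Operator norms, the optimal scaling, and the rescaled dual pair -/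

section Norms

variable {n N : ℕ}

theorem norm_toLp_mulVec_le {a b : ℕ} (p q : ℝ≥0∞) [Fact (1 ≤ p)] [Fact (1 ≤ q)]
    (A : Matrix (Fin a) (Fin b) ℂ) (v : Fin b → ℂ) :
    ‖WithLp.toLp q (A *ᵥ v)‖ ≤ opNorm p q A * ‖WithLp.toLp p v‖ :=
  (LinearMap.toContinuousLinearMap (Matrix.toLpLin p q A)).le_opNorm (WithLp.toLp p v)

theorem opNorm_nonneg {a b : ℕ} (p q : ℝ≥0∞) [Fact (1 ≤ p)] [Fact (1 ≤ q)]
    (A : Matrix (Fin a) (Fin b) ℂ) : 0 ≤ opNorm p q A := norm_nonneg _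

theorem norm_toLp_two {a : ℕ} (v : Fin a → ℂ) : ‖WithLp.toLp 2 v‖ = √(nsq v) :=
  EuclideanSpace.norm_eq _

theorem nsq_mulVec_le {a b : ℕ} (A : Matrix (Fin a) (Fin b) ℂ) (v : Fin b → ℂ) :
    nsq (A *ᵥ v) ≤ specNorm A ^ 2 * nsq v := by
  have h := norm_toLp_mulVec_le 2 2 A v
  rw [norm_toLp_two, norm_toLp_two] at h
  have h2 := pow_le_pow_left₀ (Real.sqrt_nonneg _) h 2
  rwa [mul_pow, Real.sq_sqrt (nsq_nonneg _), Real.sq_sqrt (nsq_nonneg _)] at h2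

theorem sqrt_nsq_col_le (T : Matrix (Fin N) (Fin n) ℂ) (k : Fin n) :
    √(nsq (T.col k)) ≤ opNorm 1 2 T := by
  have h := norm_toLp_mulVec_le 1 2 T (Pi.single k 1)
  rw [norm_toLp_two, Matrix.mulVec_single_one] at h
  simpa using h

theorem norm_mulVec_apply_le (Td : Matrix (Fin n) (Fin N) ℂ) (v : Fin N → ℂ) (k : Fin n) :
    ‖(Td *ᵥ v) k‖ ≤ opNorm 2 ∞ Td * √(nsq v) := by
  rw [← norm_toLp_two]
  exact (PiLp.norm_apply_le (WithLp.toLp ∞ (Td *ᵥ v)) k).trans (norm_toLp_mulVec_le 2 ∞ Td v)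

theorem ofReal_nsq {ι : Type*} [Fintype ι] (v : ι → ℂ) : ((nsq v : ℝ) : ℂ) = star v ⬝ᵥ v := by
  simp only [nsq, dotProduct, Complex.ofReal_sum, Pi.star_apply, Complex.star_def,
    Complex.conj_mul', Complex.ofReal_pow]

theorem star_mulVec_dotProduct {a b : ℕ} (A : Matrix (Fin a) (Fin b) ℂ) (v : Fin b → ℂ)
    (w : Fin a → ℂ) : star (A *ᵥ v) ⬝ᵥ w = star v ⬝ᵥ (Aᴴ *ᵥ w) := by
  rw [Matrix.star_mulVec, Matrix.dotProduct_mulVec]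

theorem norm_star_dotProduct_sq_le {ι : Type*} [Fintype ι] (v w : ι → ℂ) :
    ‖star v ⬝ᵥ w‖ ^ 2 ≤ nsq v * nsq w := by
  have := norm_sum_mul_sq_le Finset.univ (star v) w
  simpa [nsq, dotProduct] using this

theorem sqrt_nsq_conjTranspose_col_le (Td : Matrix (Fin n) (Fin N) ℂ) (k : Fin n) :
    √(nsq (Tdᴴ.col k)) ≤ opNorm 2 ∞ Td := by
  have h := norm_mulVec_apply_le Td (Tdᴴ.col k) k
  have h1 : (Td *ᵥ Tdᴴ.col k) k = (nsq (Tdᴴ.col k) : ℝ) := by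
    rw [ofReal_nsq, Matrix.mulVec]
    refine Finset.sum_congr rfl fun i _ => ?_
    simp
  rw [h1, Complex.norm_real, Real.norm_of_nonneg (nsq_nonneg _)] at h
  rcases (Real.sqrt_nonneg (nsq (Tdᴴ.col k))).eq_or_lt with h0 | h0
  · rw [← h0]
    exact opNorm_nonneg _ _ _
  · have h2 := Real.mul_self_sqrt (nsq_nonneg (Tdᴴ.col k))
    exact le_of_mul_le_mul_right (by rw [h2]; exact h) h0

theorem pinv_mul_eq_one {T : Matrix (Fin N) (Fin n) ℂ} {Td : Matrix (Fin n) (Fin N) ℂ}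
    (hT : Function.Injective fun g : Fin n → ℂ => T *ᵥ g) (hTd : IsPseudoinverse T Td) :
    Td * T = 1 := by
  refine Matrix.mulVec_injective (funext fun g => hT ?_)
  simp only [Matrix.mulVec_mulVec, ← Matrix.mul_assoc, hTd.mul_mul_left, Matrix.mul_one]

theorem one_le_opNorm_mul_opNorm [NeZero n] {T : Matrix (Fin N) (Fin n) ℂ}
    {Td : Matrix (Fin n) (Fin N) ℂ} (h : Td * T = 1) : 1 ≤ opNorm 1 2 T * opNorm 2 ∞ Td := by
  have h1 := norm_mulVec_apply_le Td (T.col 0) 0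
  have h2 : (Td *ᵥ T.col 0) 0 = (Td * T) 0 0 := rfl
  rw [h2, h] at h1
  simp only [Matrix.one_apply_eq, norm_one] at h1
  rw [mul_comm]
  exact h1.trans (mul_le_mul_of_nonneg_left (sqrt_nsq_col_le T 0) (opNorm_nonneg _ _ _))

/-- The hypothesis gives `‖UᴴU‖ ≤ 2`. With `c = Uᴴ q`, Cauchy–Schwarz on `⟨c, UᴴU c⟩` and on `⟨Uc,
q⟩` carries this over to `Uᴴ`. -/
theorem nsq_adjoint_mulVec_le {U : Matrix (Fin N) (Fin n) ℂ}
    (hU : specNorm (Uᴴ * U - 1) ≤ 1) (q : Fin N → ℂ) : nsq (Uᴴ *ᵥ q) ≤ 2 * nsq q := by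
  set c := Uᴴ *ᵥ q with hc
  have hB : nsq ((Uᴴ * U) *ᵥ c) ≤ 4 * nsq c := by
    have h1 := norm_toLp_mulVec_le 2 2 (Uᴴ * U - 1) c
    have h2 : WithLp.toLp 2 ((Uᴴ * U) *ᵥ c)
        = WithLp.toLp 2 ((Uᴴ * U - 1) *ᵥ c) + WithLp.toLp 2 c := by
      rw [Matrix.sub_mulVec, Matrix.one_mulVec, ← WithLp.toLp_add, sub_add_cancel]
    have h3 : ‖WithLp.toLp 2 ((Uᴴ * U) *ᵥ c)‖ ≤ 2 * ‖WithLp.toLp 2 c‖ := by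
      rw [h2]
      refine (norm_add_le _ _).trans ?_
      have h4 : opNorm 2 2 (Uᴴ * U - 1) * ‖WithLp.toLp 2 c‖ ≤ 1 * ‖WithLp.toLp 2 c‖ := by
        gcongr
        exact hU
      linarith
    rw [norm_toLp_two, norm_toLp_two] at h3
    have h4 := pow_le_pow_left₀ (Real.sqrt_nonneg _) h3 2
    rw [mul_pow, Real.sq_sqrt (nsq_nonneg _), Real.sq_sqrt (nsq_nonneg _)] at h4
    linarith
  have h1 : nsq (U *ᵥ c) ^ 2 ≤ nsq c * nsq ((Uᴴ * U) *ᵥ c) := by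
    refine le_trans (le_of_eq ?_) (norm_star_dotProduct_sq_le c _)
    have : star c ⬝ᵥ ((Uᴴ * U) *ᵥ c) = (nsq (U *ᵥ c) : ℝ) := by
      rw [ofReal_nsq, ← Matrix.mulVec_mulVec, star_mulVec_dotProduct U c]
    rw [this, Complex.norm_real, Real.norm_of_nonneg (nsq_nonneg _)]
  have h2 : nsq c ^ 2 ≤ nsq (U *ᵥ c) * nsq q := by
    refine le_trans (le_of_eq ?_) (norm_star_dotProduct_sq_le (U *ᵥ c) q)
    have : star (U *ᵥ c) ⬝ᵥ q = (nsq c : ℝ) := by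
      rw [ofReal_nsq, star_mulVec_dotProduct]
    rw [this, Complex.norm_real, Real.norm_of_nonneg (nsq_nonneg _)]
  have hc0 := nsq_nonneg c
  have hq0 := nsq_nonneg q
  have h3 : nsq (U *ᵥ c) ≤ 2 * nsq c := by
    refine abs_le_of_sq_le_sq' ?_ (by positivity) |>.2
    nlinarith
  rcases hc0.eq_or_lt with h0 | h0
  · rw [← h0]
    positivity
  · refine le_of_mul_le_mul_left ?_ h0
    nlinarith

/-- Injectivity bounds `T*T` below by some `c > 0`, so a small multiple of it contracts towards the
identity. By optimality, `γ` then also gives norm below `1`. -/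
theorem exists_specNorm_smul_sub_one_lt_one {T : Matrix (Fin N) (Fin n) ℂ}
    (hT : Function.Injective fun g : Fin n → ℂ => T *ᵥ g) :
    ∃ t : ℝ, 0 < t ∧ specNorm (t • (Tᴴ * T) - 1) < 1 := by
  have hinj : Function.Injective (Matrix.toLpLin 2 2 T) := by
    intro g g' hg
    have := congrArg WithLp.ofLp hg
    exact WithLp.ofLp_injective 2 (hT this)
  obtain ⟨K, -, hK⟩ := (Matrix.toLpLin 2 2 T).injective_iff_antilipschitz.1 hinj
  have hlow : ∀ g : Fin n → ℂ, nsq g ≤ (K + 1 : ℝ) ^ 2 * nsq (T *ᵥ g) := by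
    intro g
    have h1 := hK.le_mul_dist (WithLp.toLp 2 g) 0
    rw [map_zero, dist_zero_right, dist_zero_right] at h1
    have h2 : ‖WithLp.toLp 2 g‖ ≤ (K + 1) * ‖WithLp.toLp 2 (T *ᵥ g)‖ :=
      h1.trans (mul_le_mul_of_nonneg_right (by simp) (norm_nonneg _))
    rw [norm_toLp_two, norm_toLp_two] at h2
    have h4 := pow_le_pow_left₀ (Real.sqrt_nonneg _) h2 2
    rwa [mul_pow, Real.sq_sqrt (nsq_nonneg _), Real.sq_sqrt (nsq_nonneg _)] at h4
  set B := Tᴴ * T with hB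
  set c : ℝ := 1 / (K + 1 : ℝ) ^ 2 with hc
  set D : ℝ := specNorm B + 1 with hD
  have hK1 : (1 : ℝ) ≤ K + 1 := by simp
  have hc0 : 0 < c := by positivity
  have hc1 : c ≤ 1 := by
    rw [hc, div_le_one (by positivity)]
    exact one_le_pow₀ hK1
  have hBn : 0 ≤ specNorm B := opNorm_nonneg _ _ _
  have hD1 : 1 ≤ D := by linarith
  have hfrac : c ^ 2 / D ^ 2 ≤ 1 := by
    rw [div_le_one (by positivity)]
    exact pow_le_pow_left₀ hc0.le (hc1.trans hD1) 2
  have hfrac0 : 0 < c ^ 2 / D ^ 2 := by positivity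
  -- This `t` minimizes `t² D² - 2 t c`, the bound for the change in `‖t B v - v‖²` relative to
  -- `‖v‖²`.
  refine ⟨c / D ^ 2, by positivity, ?_⟩
  set t := c / D ^ 2 with ht
  have ht0 : 0 < t := by positivity
  refine lt_of_le_of_lt (b := √(1 - c ^ 2 / D ^ 2)) ?_ ?_
  · refine ContinuousLinearMap.opNorm_le_bound _ (Real.sqrt_nonneg _) fun g => ?_
    have e1 : (LinearMap.toContinuousLinearMap (Matrix.toLpLin 2 2 (t • B - 1))) g
        = WithLp.toLp 2 ((t • B - 1) *ᵥ g.ofLp) := rfl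
    have e2 : ‖g‖ = √(nsq g.ofLp) := norm_toLp_two g.ofLp
    rw [e1, e2, norm_toLp_two, ← Real.sqrt_mul (by linarith)]
    refine Real.sqrt_le_sqrt ?_
    set v := g.ofLp
    have e3 : (t • B - 1) *ᵥ v = (t • (B *ᵥ v)) - v := by
      rw [Matrix.sub_mulVec, Matrix.one_mulVec, Matrix.smul_mulVec]
    have e4 : nsq (t • (B *ᵥ v) - v)
        = t ^ 2 * nsq (B *ᵥ v) - 2 * t * (star v ⬝ᵥ (B *ᵥ v)).re + nsq v := by
      simp only [nsq, dotProduct, Complex.re_sum, Finset.mul_sum, ← Finset.sum_add_distrib,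
        ← Finset.sum_sub_distrib]
      refine Finset.sum_congr rfl fun i _ => ?_
      simp only [← Complex.normSq_eq_norm_sq, Complex.normSq_apply, Pi.sub_apply, Pi.smul_apply,
        Complex.sub_re, Complex.sub_im, Complex.real_smul, Complex.mul_re, Complex.mul_im,
        Complex.ofReal_re, Complex.ofReal_im, Pi.star_apply, Complex.star_def, Complex.conj_re,
        Complex.conj_im]
      ring
    have e5 : star v ⬝ᵥ (B *ᵥ v) = (nsq (T *ᵥ v) : ℝ) := by
      rw [ofReal_nsq, hB, ← Matrix.mulVec_mulVec, Matrix.dotProduct_mulVec, Matrix.star_mulVec]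
    have e6 : nsq (B *ᵥ v) ≤ D ^ 2 * nsq v := by
      refine (nsq_mulVec_le B v).trans ?_
      have := nsq_nonneg v
      gcongr
      linarith
    have e7 : c * nsq v ≤ nsq (T *ᵥ v) := by
      rw [hc, one_div, inv_mul_le_iff₀ (by positivity)]
      exact hlow v
    rw [e3, e4, e5, Complex.ofReal_re]
    have e8 : t ^ 2 * nsq (B *ᵥ v) ≤ t ^ 2 * (D ^ 2 * nsq v) := by gcongr
    have e9 : 2 * t * (c * nsq v) ≤ 2 * t * nsq (T *ᵥ v) := by gcongr
    have e10 : t ^ 2 * (D ^ 2 * nsq v) = c ^ 2 / D ^ 2 * nsq v := by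
      rw [ht]; field_simp
    have e11 : 2 * t * (c * nsq v) = 2 * (c ^ 2 / D ^ 2 * nsq v) := by
      rw [ht]; field_simp
    linarith
  · rw [Real.sqrt_lt' one_pos]
    linarith

/-- An uncertainty principle: for `z = Ux` one has `‖z‖² = ⟨Uᴴ z, Vᴴ z⟩`, and both factors have
squared norm at most `μ * J.card * ‖z‖²`. It lets the rounding of batch sizes be absorbed into
constants. -/
theorem one_le_incoherence_mul_card [NeZero n] {U V : Matrix (Fin N) (Fin n) ℂ} {μ M : ℝ}
    (h : IsIncoherentPair U V μ M) {x : Fin n → ℂ} {J : Finset (Fin N)}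
    (hJ : ∀ i, i ∈ J ↔ (U *ᵥ x) i ≠ 0) (hJ0 : J.Nonempty) : 1 ≤ μ * J.card := by
  set z := U *ᵥ x with hz
  have hzJ : ∀ i, i ∉ J → z i = 0 := fun i hi => by
    by_contra hcon
    exact hi ((hJ i).2 hcon)
  have hx : x = Vᴴ *ᵥ z := by rw [hz, Matrix.mulVec_mulVec, h.dual, Matrix.one_mulVec]
  obtain ⟨i, hi⟩ := hJ0
  have hz0 : 0 < nsq z := by
    have h1 : 0 < ‖z i‖ := norm_pos_iff.2 ((hJ i).1 hi)
    have h2 := norm_sq_le_nsq z i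
    nlinarith
  have hn : (0 : ℝ) < n := by exact_mod_cast Nat.pos_of_neZero n
  have h1 : ((nsq z : ℝ) : ℂ) = star (Uᴴ *ᵥ z) ⬝ᵥ (Vᴴ *ᵥ z) := by
    rw [ofReal_nsq, ← hx, star_mulVec_dotProduct Uᴴ z, Matrix.conjTranspose_conjTranspose]
  have hA : ∀ A : Matrix (Fin N) (Fin n) ℂ, (∀ i k, n * ‖A i k‖ ^ 2 ≤ μ) →
      nsq (Aᴴ *ᵥ z) ≤ μ * J.card * nsq z := by
    intro A hA
    refine (Finset.sum_le_card_nsmul _ _ (J.card * μ * nsq z / n) fun k _ => ?_).trans_eq ?_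
    · rw [le_div_iff₀ hn, mul_comm]
      exact norm_adjoint_mulVec_sq_le hA hzJ k
    · rw [Finset.card_univ, Fintype.card_fin, nsmul_eq_mul, mul_div_cancel₀ _ hn.ne']
      ring
  have h2 : nsq z ^ 2 ≤ (μ * J.card * nsq z) ^ 2 := by
    have h3 := norm_star_dotProduct_sq_le (Uᴴ *ᵥ z) (Vᴴ *ᵥ z)
    rw [← h1, Complex.norm_real, Real.norm_of_nonneg hz0.le] at h3
    refine h3.trans ?_
    rw [sq (μ * J.card * nsq z)]
    have h4 := hA U h.left_entry
    exact mul_le_mul h4 (hA V h.right_entry) (nsq_nonneg _) ((nsq_nonneg _).trans h4)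
  have h3 : 0 ≤ μ * J.card * nsq z :=
    (nsq_nonneg _).trans (hA U h.left_entry)
  have h4 := abs_le_of_sq_le_sq' h2 h3 |>.2
  exact le_of_mul_le_mul_right (by rw [one_mul]; exact h4) hz0

theorem max_le_incoherence (T Tt : Matrix (Fin N) (Fin n) ℂ) (γ : ℝ) (k : Fin n) :
    max ((n : ℝ) * ‖(γ ^ (1 / 2 : ℝ)) • T.col k‖ ^ 2)
      ((n : ℝ) * ‖(γ ^ (-(1 / 2) : ℝ)) • Tt.col k‖ ^ 2) ≤ incoherence T Tt γ :=
  le_ciSup (f := fun k => max ((n : ℝ) * ‖(γ ^ (1 / 2 : ℝ)) • T.col k‖ ^ 2)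
      ((n : ℝ) * ‖(γ ^ (-(1 / 2) : ℝ)) • Tt.col k‖ ^ 2)) (Set.finite_range _).bddAbove k

theorem incoherence_nonneg [NeZero n] (T Tt : Matrix (Fin N) (Fin n) ℂ) (γ : ℝ) :
    0 ≤ incoherence T Tt γ :=
  le_trans (le_max_of_le_left (by positivity)) (max_le_incoherence T Tt γ 0)

theorem nsq_smul {a : ℕ} (r : ℝ) (v : Fin a → ℂ) : nsq (r • v) = r ^ 2 * nsq v := by
  simp [nsq, mul_pow, Finset.mul_sum]

/-- The powers of `γ` cancel in duality and in the product of column norms, so `M` does not depend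
on the scaling. -/
theorem isIncoherentPair_smul {T : Matrix (Fin N) (Fin n) ℂ}
    {Td : Matrix (Fin n) (Fin N) ℂ} (hdual : Td * T = 1) {γ : ℝ} (hγ : 0 < γ)
    (hspec : specNorm (γ • (Tᴴ * T) - 1) ≤ 1) :
    IsIncoherentPair ((γ ^ (1 / 2 : ℝ)) • T) ((γ ^ (-(1 / 2) : ℝ)) • Tdᴴ)
      (incoherence T Tdᴴ γ) (opNorm 1 2 T * opNorm 2 ∞ Td) := by
  have hprod : γ ^ (-(1 / 2) : ℝ) * γ ^ (1 / 2 : ℝ) = 1 := by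
    rw [← Real.rpow_add hγ]
    simp
  have hsq : γ ^ (1 / 2 : ℝ) * γ ^ (1 / 2 : ℝ) = γ := by
    rw [← Real.rpow_add hγ]
    norm_num
  have hconj : ∀ (r : ℝ) {a b : ℕ} (A : Matrix (Fin a) (Fin b) ℂ), (r • A)ᴴ = r • Aᴴ := by
    intro r a b A
    rw [Matrix.conjTranspose_smul, star_trivial]
  refine ⟨?_, fun i k => ?_, fun i k => ?_, nsq_adjoint_mulVec_le ?_, fun k => ?_⟩
  · rw [hconj, Matrix.conjTranspose_conjTranspose, Matrix.smul_mul, Matrix.mul_smul, smul_smul,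
      hprod, one_smul, hdual]
  · refine le_trans ?_ ((le_max_left _ _).trans (max_le_incoherence T Tdᴴ γ k))
    gcongr
    exact norm_le_pi_norm ((γ ^ (1 / 2 : ℝ)) • T.col k) i
  · refine le_trans ?_ ((le_max_right _ _).trans (max_le_incoherence T Tdᴴ γ k))
    gcongr
    exact norm_le_pi_norm ((γ ^ (-(1 / 2) : ℝ)) • Tdᴴ.col k) i
  · rw [hconj, Matrix.smul_mul, Matrix.mul_smul, smul_smul, hsq]
    exact hspec
  · have e1 : ((γ ^ (1 / 2 : ℝ)) • T).col k = (γ ^ (1 / 2 : ℝ)) • T.col k := rfl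
    have e2 : ((γ ^ (-(1 / 2) : ℝ)) • Tdᴴ).col k = (γ ^ (-(1 / 2) : ℝ)) • Tdᴴ.col k := rfl
    rw [e1, e2, nsq_smul, nsq_smul, mul_pow]
    have h1 := (Real.sqrt_le_left (opNorm_nonneg 1 2 T)).1 (sqrt_nsq_col_le T k)
    have h2 := (Real.sqrt_le_left (opNorm_nonneg 2 ∞ Td)).1 (sqrt_nsq_conjTranspose_col_le Td k)
    calc _ = (γ ^ (-(1 / 2) : ℝ) * γ ^ (1 / 2 : ℝ)) ^ 2
          * (nsq (T.col k) * nsq (Tdᴴ.col k)) := by ring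
      _ = nsq (T.col k) * nsq (Tdᴴ.col k) := by rw [hprod]; ring
      _ ≤ _ := mul_le_mul h1 h2 (nsq_nonneg _) (by positivity)

theorem IsStrictMinimizer.of_smul {T : Matrix (Fin N) (Fin n) ℂ} {r : ℝ} (hr : 0 < r)
    {x : Fin n → ℂ} {S : Set (Fin n)} (h : IsStrictMinimizer (r • T) x S) :
    IsStrictMinimizer T x S := by
  intro g hg hne
  have h1 : ∀ v : Fin n → ℂ, l1Norm ((r • T) *ᵥ v) = r * l1Norm (T *ᵥ v) := by
    intro v
    rw [Matrix.smul_mulVec, l1Norm, l1Norm, Finset.mul_sum]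
    refine Finset.sum_congr rfl fun i _ => ?_
    simp [abs_of_pos hr]
  have h2 := h g hg hne
  rw [h1, h1] at h2
  exact lt_of_mul_lt_mul_left h2 hr.le

theorem isStrictMinimizer_of_mulVec_eq_zero {T : Matrix (Fin N) (Fin n) ℂ}
    (hT : Function.Injective fun g : Fin n → ℂ => T *ᵥ g) {x : Fin n → ℂ} (hx : T *ᵥ x = 0)
    (S : Set (Fin n)) : IsStrictMinimizer T x S := by
  intro g _ hne
  have h1 : T *ᵥ g ≠ 0 := fun h0 => hne (hT (by simpa using h0))
  rw [Matrix.mulVec_add, hx, zero_add]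
  obtain ⟨i, hi⟩ := Function.ne_iff.1 h1
  have h2 : ‖(T *ᵥ g) i‖ ≤ l1Norm (T *ᵥ g) :=
    Finset.single_le_sum (f := fun i => ‖(T *ᵥ g) i‖) (fun _ _ => norm_nonneg _)
      (Finset.mem_univ i)
  have h3 : 0 < ‖(T *ᵥ g) i‖ := norm_pos_iff.2 hi
  have h4 : l1Norm (0 : Fin N → ℂ) = 0 := by simp [l1Norm]
  linarith

end Norms

end TransformSparse

/-! ### The main theorem -/

theorem theorem1 :
    ∃ C : ℝ, 0 < C ∧
      ∀ (n N m s : ℕ) (_ : 0 < n) (T : Matrix (Fin N) (Fin n) ℂ)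
        (_ : Function.Injective (fun g : Fin n → ℂ => T *ᵥ g))
        (Td : Matrix (Fin n) (Fin N) ℂ) (_ : TransformSparse.IsPseudoinverse T Td)
        (γ : ℝ) (_ : TransformSparse.IsOptimalScaling T γ)
        (x : Fin n → ℂ) (_ : TransformSparse.IsSparse s (T *ᵥ x))
        (β : ℝ)
        (_ : C * (1 + β) * TransformSparse.incoherence T Tdᴴ γ * (s : ℝ)
              / (1 - TransformSparse.specNorm (γ • (Tᴴ * T) - 1))
              * (Real.log (N : ℝ)
                + Real.log (TransformSparse.opNorm 1 2 T * TransformSparse.opNorm 2 ∞ Td))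
            ≤ (m : ℝ))
        {Ω : Type*} [MeasurableSpace Ω] (P : Measure Ω) [IsProbabilityMeasure P]
        (ω : Fin m → Ω → Fin n)
        (_ : ∀ j, HasLaw (ω j) (uniformOn (Set.univ : Set (Fin n))) P)
        (_ : iIndepFun ω P),
        1 - Real.exp (-β) - 3 / (n : ℝ)
          ≤ P.real {w | TransformSparse.IsRecovered T x (fun j => ω j w)} := by
  open TransformSparse in
  classical
  -- There are `2⌈β⌉ ≤ 2(1 + β)` groups, each with the constant `200000`.
  refine ⟨400000, by norm_num, ?_⟩
  intro n N m s hn T hT Td hTd γ hγ x hs β hm Ω _ P _ ω hlaw hind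
  have : NeZero n := ⟨hn.ne'⟩
  have hn' : (0 : ℝ) < n := by exact_mod_cast hn
  have h3n : 0 ≤ 3 / (n : ℝ) := by positivity
  rcases le_or_gt β 0 with hβ | hβ
  · have h1 : 1 ≤ Real.exp (-β) := Real.one_le_exp (by linarith)
    have h2 : 0 ≤ P.real {w | IsRecovered T x (fun j => ω j w)} := measureReal_nonneg
    linarith
  rcases Nat.lt_or_ge n 2 with hn2 | hn2
  · have h1 : 1 ≤ 3 / (n : ℝ) := by
      rw [le_div_iff₀ hn']
      have : (n : ℝ) ≤ 1 := by exact_mod_cast Nat.lt_succ_iff.1 hn2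
      linarith
    have h2 : 0 ≤ P.real {w | IsRecovered T x (fun j => ω j w)} := measureReal_nonneg
    have h4 := Real.exp_pos (-β)
    linarith
  by_cases hx : T *ᵥ x = 0
  · have h1 : {w | IsRecovered T x (fun j => ω j w)} = Set.univ :=
      Set.eq_univ_of_forall fun w => (isStrictMinimizer_of_mulVec_eq_zero hT hx _).isRecovered
    rw [h1, probReal_univ]
    linarith [Real.exp_pos (-β)]
  have hnN : n ≤ N := by
    have := LinearMap.finrank_le_finrank_of_injective (f := T.mulVecLin) hT
    simpa using this
  have hdual := pinv_mul_eq_one hT hTd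
  set μ := incoherence T Tdᴴ γ with hμdef
  set M := opNorm 1 2 T * opNorm 2 ∞ Td with hMdef
  set δ := specNorm (γ • (Tᴴ * T) - 1) with hδdef
  have hμ : 0 ≤ μ := incoherence_nonneg _ _ _
  have hM : 1 ≤ M := one_le_opNorm_mul_opNorm hdual
  have hδ0 : 0 ≤ δ := opNorm_nonneg _ _ _
  have hδ1 : δ < 1 := by
    obtain ⟨t, ht, ht1⟩ := exists_specNorm_smul_sub_one_lt_one hT
    exact lt_of_le_of_lt (hγ.2 ht) ht1
  have hpair := isIncoherentPair_smul hdual hγ.1 hδ1.le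
  have hr : 0 < γ ^ (1 / 2 : ℝ) := Real.rpow_pos_of_pos hγ.1 _
  set J : Finset (Fin N) := Finset.univ.filter fun i => (T *ᵥ x) i ≠ 0 with hJdef
  have hJ : ∀ i, i ∈ J ↔ (((γ ^ (1 / 2 : ℝ)) • T) *ᵥ x) i ≠ 0 := by
    intro i
    rw [Matrix.smul_mulVec, Pi.smul_apply, smul_ne_zero_iff]
    simp only [hJdef, Finset.mem_filter, Finset.mem_univ, true_and]
    exact ⟨fun h => ⟨hr.ne', h⟩, And.right⟩
  have hJ0 : J.Nonempty := by
    obtain ⟨i, hi⟩ := Function.ne_iff.1 hx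
    exact ⟨i, by simpa [hJdef] using hi⟩
  have hJs : (J.card : ℝ) ≤ s := by
    have h1 : Function.support (T *ᵥ x) = (J : Set (Fin N)) := by
      ext i
      simp [hJdef]
    have h2 : (J : Set (Fin N)).ncard ≤ s := h1 ▸ hs
    rw [Set.ncard_coe_finset] at h2
    exact_mod_cast h2
  obtain ⟨b, L, hcard, hfrac⟩ := exists_frac_not_isStrictMinimizer_le hpair hM (hn2.trans hnN)
    hnN hJ hJ0 (one_le_incoherence_mul_card hpair hJ hJ0)
  have hlog : 0 ≤ Real.log N + Real.log M :=
    add_nonneg (Real.log_natCast_nonneg N) (Real.log_nonneg hM)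
  have hsize : Fintype.card (Fin (2 * ⌈β⌉₊) × SampleIdx b L) ≤ Fintype.card (Fin m) := by
    rw [Fintype.card_prod, Fintype.card_fin, Fintype.card_fin, ← Nat.cast_le (α := ℝ)]
    push_cast
    -- The division by `1 - δ` only enlarges the required `m`, because `0 < 1 - δ ≤ 1`.
    have h1 := Nat.ceil_lt_add_one hβ.le
    have h2 : 400000 * (1 + β) * (μ * s) * (Real.log N + Real.log M)
        ≤ 400000 * (1 + β) * μ * s / (1 - δ) * (Real.log N + Real.log M) := by
      gcongr
      rw [le_div_iff₀ (by linarith)]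
      have h3 : 0 ≤ (1 + β) * (μ * s) := by positivity
      nlinarith
    calc 2 * (⌈β⌉₊ : ℝ) * Fintype.card (SampleIdx b L)
        ≤ 2 * (1 + β) * (200000 * (μ * J.card) * (Real.log N + Real.log M)) := by
          gcongr
          linarith
      _ ≤ 2 * (1 + β) * (200000 * (μ * s) * (Real.log N + Real.log M)) := by gcongr
      _ = 400000 * (1 + β) * (μ * s) * (Real.log N + Real.log M) := by ring
      _ ≤ m := h2.trans hm
  -- The groups occupy disjoint sets of sample indices, so they are independent. Leftover samples
  -- only enlarge the sampled set.
  obtain ⟨e⟩ := Function.Embedding.nonempty_of_card_le hsize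
  set bad : (SampleIdx b L → Fin n) → Prop :=
    fun p => ¬ IsStrictMinimizer ((γ ^ (1 / 2 : ℝ)) • T) x (Set.range p) with hbad
  have hfail : P.real {w | ∀ g, bad fun j => ω (e (g, j)) w} ≤ Real.exp (-β) := by
    have h1 := measureReal_eq_frac P (fun j => hlaw (e j)) (hind.precomp e.injective)
      (fun p : Fin (2 * ⌈β⌉₊) × SampleIdx b L → Fin n => ∀ g, bad fun j => p (g, j))
    rw [h1]
    exact frac_forall_le_exp hfrac β
  have hcover : Set.univ ⊆ {w | IsRecovered T x (fun j => ω j w)}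
      ∪ {w | ∀ g, bad fun j => ω (e (g, j)) w} := by
    intro w _
    by_cases hw : ∀ g, bad fun j => ω (e (g, j)) w
    · exact Or.inr hw
    · left
      push Not at hw
      obtain ⟨g, hg⟩ := hw
      simp only [hbad, not_not] at hg
      refine ((hg.of_smul hr).mono ?_).isRecovered
      rintro _ ⟨j, rfl⟩
      exact ⟨e (g, j), rfl⟩
  have h1 := (measureReal_mono (μ := P) hcover).trans (measureReal_union_le _ _)
  rw [probReal_univ] at h1
  linarith
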